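/- Let $n\ge p>0$ be integers, let $f=\sum_{i=1}^N f_i$ with $f_1,\dots,f_N:\mathbb{R}^{n\times p}\to\mathbb{R}$ smooth ($C^\infty$), let $\|\cdot\|$ be the Frobenius norm, $\nabla f$ the Euclidean gradient, $\mathrm{skew}(A)=(A-A^\top)/2$, and $$h(X)=X^\top X-I_p\in\mathrm{Sym}(p),\qquad \mathrm{grad} f(X)=2\,\mathrm{skew}(\nabla f(X)X^\top)X,\qquad \nabla\mathcal N(X)=2X(X^\top X-I_p).$$ Let $R,\underline\sigma>0$ be such that the smallest singular value of $\mathrm{D}h(X):\mathbb{R}^{n\times p}\to\mathrm{Sym}(p)$ satisfies $\sigma_{\min}(\mathrm{D}h(X))\ge\underline\sigma$ for every $X$ in the safe region $\mathcal C_R=\{X\in\mathbb{R}^{n\times p}:\|h(X)\|\le R\}$. Let $\nu$ be a probability distribution of a sketch matrix $S\in\mathbb{R}^{n\times r}$ such that $\mathbb{E}[SS^\top]=I_n$ and $SS^\top$ has finite variance. Let $\nabla f_\xi$ be an unbiased stochastic gradient of $f$, i.e. $\mathbb{E}_\xi[\nabla f_\xi(X)]=\nabla f(X)$ for all $X$ (the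 exact choice $\nabla f_\xi=\nabla f$ is allowed), such that $\mathbb{E}_\xi\|\nabla f_\xi(X)-\nabla f(X)\|^2$ is bounded over $X\in\mathcal C_R$. For sketches $S,S'$ and a sample $\xi$ put $$d_{\mathrm T}(X)=2\,\mathrm{skew}(\nabla f_\xi(X)X^\top SS^\top)S'S'^\top X,\qquad d_{\mathrm N}(X)=2S'S'^\top X(X^\top SS^\top X-I_p).$$ Fix $\omega_{\mathrm T},\omega_{\mathrm N}>0$ and an integer $T\ge1$. In each iteration $k=0,1,2,\dots$ draw $S_k,S_k'$ with law $\nu$ and a sample $\xi_k$, all independent of each other and of all other iterations, and let $d_{\mathrm T}^k,d_{\mathrm N}^k$ be the above directions for $S_k,S_k',\xi_k$. Consider, from a deterministic starting point $X_0\in\mathbb{R}^{n\times p}$ and with step sizes $\alpha_k=\alpha_0/\sqrt{k+1}$, * the sketched landing method: $X_{k+1}=X_k-\alpha_k\big(\omega_{\mathrm T}d_{\mathrm T}^k(X_k)+\omega_{\mathrm N}d_{\mathrm N}^k(X_k)\big)$; * its SVRG variant: $X_{k+1}=X_k-\alpha_k\big(\omega_{\mathrm T}[\mathrm{grad} f(Y_k)-d_{\mathrm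 T}^k(Y_k)+d_{\mathrm T}^k(X_k)]+\omega_{\mathrm N}[\nabla\mathcal N(Y_k)-d_{\mathrm N}^k(Y_k)+d_{\mathrm N}^k(X_k)]\big)$, where $Y_k=X_j$ for $j$ the largest multiple of $T$ with $j\le k$. Theorem. There is $\bar\alpha>0$ such that for every $\alpha_0\in(0,\bar\alpha]$ there is a constant $C$, independent of $X_0$ and of $K$, such that the following holds for the iterates of either method. 1. If all iterates $X_0,X_1,\dots$ lie in $\mathcal C_R$ almost surely, then for all $K\ge1$ $$\inf_{k\le K}\mathbb{E}\big[\|\mathrm{grad} f(X_k)\|^2\big]\le C\,\frac{1+\log K}{\sqrt K},\qquad \inf_{k\le K}\mathbb{E}\big[\|h(X_k)\|^2\big]\le C\,\frac{1+\log K}{\sqrt K},$$ i.e. both quantities are $\tilde{\mathcal O}(1/\sqrt K)$. 2. Without this assumption, let $A_k$ be the event that $X_0,\dots,X_k\in\mathcal C_R$. Then for all $K\ge1$ $$\inf_{k\le K}\mathbb{E}\big[\mathbf 1_{A_k}\|\mathrm{grad} f(X_k)\|^2\big]\le C\,\frac{1+\log K}{\sqrt K},\qquad \inf_{k\le K}\mathbb{E}\big[\mathbf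 1_{A_k}\|h(X_k)\|^2\big]\le C\,\frac{1+\log K}{\sqrt K}.$$ -/

import Mathlib

open MeasureTheory ProbabilityTheory
open scoped Matrix NNReal ENNReal

namespace SketchedLanding

noncomputable section

/-- The space `ℝ^{n × p}` of real matrices with the Frobenius inner product and norm, as the
Euclidean space on the `n * p` entries. -/
abbrev Mat (n p : ℕ) : Type := EuclideanSpace ℝ (Fin n × Fin p)

/-- An element of `ℝ^{n × p}`, read as a matrix. -/
def toM {n p : ℕ} (X : Mat n p) : Matrix (Fin n) (Fin p) ℝ := Matrix.of fun i j => X (i, j)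

/-- A matrix, read as an element of `ℝ^{n × p}`. -/
def ofM {n p : ℕ} (A : Matrix (Fin n) (Fin p) ℝ) : Mat n p := WithLp.toLp 2 fun ij => A ij.1 ij.2

@[simp] lemma toM_ofM {n p : ℕ} (A : Matrix (Fin n) (Fin p) ℝ) : toM (ofM A) = A := rfl

@[simp] lemma ofM_toM {n p : ℕ} (X : Mat n p) : ofM (toM X) = X := rfl

/-! ### The Stiefel constraint and the safe region -/

/-- `Sym(p)`, the space of symmetric `p × p` matrices (with the Frobenius inner product). -/
def symMat (p : ℕ) : Submodule ℝ (Mat p p) where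
  carrier := {A | (toM A).IsSymm}
  add_mem' hA hB := Matrix.IsSymm.add hA hB
  zero_mem' := Matrix.isSymm_zero
  smul_mem' c _ hA := Matrix.IsSymm.smul hA c

/-- The constraint function `h : ℝ^{n × p} → Sym(p)`, `h(X) = Xᵀ X - I_p`. -/
def stiefelConstraint {n p : ℕ} (X : Mat n p) : symMat p :=
  ⟨ofM ((toM X)ᵀ * toM X - 1), by
    change ((toM X)ᵀ * toM X - 1).IsSymm
    simp [Matrix.IsSymm, Matrix.transpose_mul]⟩

/-- The smallest singular value of a linear map `A : E → F` with `0 < dim F ≤ dim E`, that is,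
the minimum of `‖A* y‖` over the unit vectors `y` of `F`. -/
def sigmaMin {E F : Type*} [NormedAddCommGroup E] [InnerProductSpace ℝ E] [FiniteDimensional ℝ E]
    [NormedAddCommGroup F] [InnerProductSpace ℝ F] [FiniteDimensional ℝ F] (A : E →ₗ[ℝ] F) : ℝ :=
  ⨅ y : Metric.sphere (0 : F) 1, ‖LinearMap.adjoint A (y : F)‖

/-- The differential `Dh(X) : ℝ^{n × p} → Sym(p)` of the constraint function. -/
def constraintDeriv {n p : ℕ} (X : Mat n p) : Mat n p →ₗ[ℝ] symMat p :=
  (fderiv ℝ (stiefelConstraint (n := n) (p := p)) X : Mat n p →L[ℝ] symMat p)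

/-- The region `C_R = {X : ‖h(X)‖ ≤ R}`. -/
def safeRegion (n p : ℕ) (R : ℝ) : Set (Mat n p) :=
  {X | ‖stiefelConstraint X‖ ≤ R}

/-! ### The landing field and its sketched estimates -/

/-- The skew-symmetric part `skew(A) = (A - Aᵀ) / 2`. -/
def skewPart {n : ℕ} (A : Matrix (Fin n) (Fin n) ℝ) : Matrix (Fin n) (Fin n) ℝ :=
  (1 / 2 : ℝ) • (A - Aᵀ)

/-- `grad f(X) = 2 skew(∇f(X) Xᵀ) X`, where `∇f` is the Euclidean gradient. -/
def riemGrad {n p : ℕ} (f : Mat n p → ℝ) (X : Mat n p) : Mat n p :=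
  ofM ((2 : ℝ) • (skewPart (toM (gradient f X) * (toM X)ᵀ) * toM X))

/-- `∇𝒩(X) = 2 X (Xᵀ X - I_p)`, the gradient of the infeasibility `𝒩(X) = ‖h(X)‖² / 2`. -/
def landingNormal {n p : ℕ} (X : Mat n p) : Mat n p :=
  ofM ((2 : ℝ) • (toM X * ((toM X)ᵀ * toM X - 1)))

/-- The `n × n` matrix `S Sᵀ` of a sketch `S`. -/
def sketchProj {n r : ℕ} (S : Mat n r) : Matrix (Fin n) (Fin n) ℝ := toM S * (toM S)ᵀ

/-- The sketched tangent component `2 skew(g Xᵀ S Sᵀ) S' S'ᵀ X` at `X`, for sketches `S`, `S'`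
and an estimate `g` of `∇f(X)`. -/
def sketchTangent {n p r : ℕ} (S S' : Mat n r) (g X : Mat n p) : Mat n p :=
  ofM ((2 : ℝ) • (skewPart (toM g * (toM X)ᵀ * sketchProj S) * sketchProj S' * toM X))

/-- The sketched normal component `2 S' S'ᵀ X (Xᵀ S Sᵀ X - I_p)` at `X`. -/
def sketchNormal {n p r : ℕ} (S S' : Mat n r) (X : Mat n p) : Mat n p :=
  ofM ((2 : ℝ) • (sketchProj S' * toM X * ((toM X)ᵀ * sketchProj S * toM X - 1)))

/-! ### Random ingredients -/

/-- `ν` is an admissible distribution of the sketch matrix `S ∈ ℝ^{n × r}`: `E[S Sᵀ] = I_n`, and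
`S Sᵀ` has finite variance (so that its entries are integrable). -/
structure IsSketchLaw {n r : ℕ} (ν : Measure (Mat n r)) : Prop where
  isProbabilityMeasure : IsProbabilityMeasure ν
  finite_variance : ∫⁻ S, ‖ofM (sketchProj S - 1)‖ₑ ^ 2 ∂ν < ∞
  unbiased : ∀ i j, ∫ S, sketchProj S i j ∂ν = (1 : Matrix (Fin n) (Fin n) ℝ) i j

/-- `G ξ X = ∇f_ξ(X)`, with `ξ` distributed according to `π`, is an unbiased stochastic gradient
of `f`, with variance bounded on the set `𝒞`. -/
structure IsStochGrad {n p : ℕ} {Ξ : Type*} [MeasurableSpace Ξ] (f : Mat n p → ℝ)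
    (𝒞 : Set (Mat n p)) (π : Measure Ξ) (G : Ξ → Mat n p → Mat n p) : Prop where
  isProbabilityMeasure : IsProbabilityMeasure π
  measurable : Measurable (Function.uncurry G)
  integrable : ∀ X, Integrable (fun ξ => G ξ X) π
  unbiased : ∀ X, ∫ ξ, G ξ X ∂π = gradient f X
  bounded_variance : ∃ V : ℝ≥0, ∀ X ∈ 𝒞, ∫⁻ ξ, ‖G ξ X - gradient f X‖ₑ ^ 2 ∂π ≤ V

/-- The random draws of a run on the probability space `(Ω, P)`. In iteration `k`, sketches `S k`
and `S' k` with law `ν` and a sample `ξ k` with law `π` are drawn, independently of each other and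
of all other iterations. -/
structure IsSampling {n r : ℕ} {Ξ Ω : Type*} [MeasurableSpace Ξ] [MeasurableSpace Ω]
    (P : Measure Ω) (ν : Measure (Mat n r)) (π : Measure Ξ)
    (S S' : ℕ → Ω → Mat n r) (ξ : ℕ → Ω → Ξ) : Prop where
  measurable_sketch : ∀ k, Measurable (S k)
  measurable_sketch' : ∀ k, Measurable (S' k)
  measurable_sample : ∀ k, Measurable (ξ k)
  law : ∀ k, P.map (fun ω => (S k ω, S' k ω, ξ k ω)) = ν.prod (ν.prod π)
  indep : iIndepFun (fun k ω => (S k ω, S' k ω, ξ k ω)) P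

/-! ### The two algorithms -/

/-- `X` is the sequence of iterates of the sketched landing method started at `X₀`:
`X_{k+1} = X_k - α_k (ω_T d_T(X_k) + ω_N d_N(X_k))`, with the sketched directions `d_T`, `d_N`. -/
structure IsSketchedLandingRun {n p r : ℕ} {Ξ Ω : Type*} (G : Ξ → Mat n p → Mat n p)
    (ωT ωN : ℝ) (α : ℕ → ℝ) (S S' : ℕ → Ω → Mat n r) (ξ : ℕ → Ω → Ξ)
    (X₀ : Mat n p) (X : ℕ → Ω → Mat n p) : Prop where
  init : ∀ ω, X 0 ω = X₀
  step : ∀ k ω, X (k + 1) ω = X k ω - α k •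
    (ωT • sketchTangent (S k ω) (S' k ω) (G (ξ k ω) (X k ω)) (X k ω) +
      ωN • sketchNormal (S k ω) (S' k ω) (X k ω))

/-- The SVRG tangent component at `X`, with reference point `Y`. -/
def svrgTangent {n p r : ℕ} (f : Mat n p → ℝ) (g : Mat n p → Mat n p) (S S' : Mat n r)
    (Y X : Mat n p) : Mat n p :=
  riemGrad f Y - sketchTangent S S' (g Y) Y + sketchTangent S S' (g X) X

/-- The SVRG normal component at `X`, with reference point `Y`. -/
def svrgNormal {n p r : ℕ} (S S' : Mat n r) (Y X : Mat n p) : Mat n p :=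
  landingNormal Y - sketchNormal S S' Y + sketchNormal S S' X

/-- `X` is the sequence of iterates of the SVRG sketched landing method started at `X₀`. The
reference point in iteration `k` is `X_j`, where `j = k - k % T` is the last multiple of `T` that
is at most `k`. -/
structure IsSVRGLandingRun {n p r : ℕ} {Ξ Ω : Type*} (f : Mat n p → ℝ)
    (G : Ξ → Mat n p → Mat n p) (T : ℕ) (ωT ωN : ℝ) (α : ℕ → ℝ)
    (S S' : ℕ → Ω → Mat n r) (ξ : ℕ → Ω → Ξ) (X₀ : Mat n p) (X : ℕ → Ω → Mat n p) : Prop where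
  init : ∀ ω, X 0 ω = X₀
  step : ∀ k ω, X (k + 1) ω = X k ω - α k •
    (ωT • svrgTangent f (G (ξ k ω)) (S k ω) (S' k ω) (X (k - k % T) ω) (X k ω) +
      ωN • svrgNormal (S k ω) (S' k ω) (X (k - k % T) ω) (X k ω))

/-- The event that `X_0, …, X_k` all lie in the safe region. -/
def safeUpTo {n p : ℕ} {Ω : Type*} (R : ℝ) (X : ℕ → Ω → Mat n p) (k : ℕ) : Set Ω :=
  {ω | ∀ j ≤ k, X j ω ∈ safeRegion n p R}

end

end SketchedLanding

namespace SketchedLanding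

noncomputable section

/-! ### Stochastic descent with independent draws -/

/-! Both methods are stochastic descent on one merit function, `L(X) = f(q(X)) + (μ/2)‖h(X)‖² + b`,
where `q(X) = X(3 - XᵀX)/2` is a Newton step towards the polar factor (`polarStep`). Along the
normal field, the derivative of `q` is `-3 X h(X)²`. The normal part of the landing field therefore
changes `f ∘ q` only to order `‖h‖²`, and the penalty absorbs this for large `μ` because `σ‖h‖ ≤
‖∇𝒩‖`. Along `grad f`, which is tangent to the level sets of `h`, the derivative of `f ∘ q` is at
least a multiple of `‖grad f‖²` up to cross terms `‖h‖‖grad f‖`, which Young's inequality removes.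
Hence `DL[Λ] ≥ c(‖grad f‖² + ‖h‖²)` on the safe region for the landing field `Λ`
(`exists_merit_descent`).

The sketched direction has mean `Λ`, being linear separately in `SSᵀ`, `S'S'ᵀ` and `∇f_ξ`. The SVRG
correction has mean zero, so its direction has mean `Λ` too. The safe region is compact, so second
moments are uniformly bounded there (`exists_isLyapunov`).

Each draw is independent of the past. A second-order upper bound on `L`, integrated over the event
of not having left the safe region, gives an expected decrease `α_k E[1_{A_k} Q]` up to `O(α_k²)`,
where `Q = c(‖grad f‖² + ‖h‖²)` (`IsLyapunov.setLIntegral_succ_le`). Telescoping, with `∑ α_k` at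
least of order `√K` and `∑ α_k²` at most of order `1 + log K`, gives the rate
(`IsLyapunov.exists_le_rate`). If the iterates never leave, the stopping events have full measure.
-/

lemma lintegral_comp_of_indepFun {Ω 𝓗 𝓓 : Type*} [MeasurableSpace Ω] [MeasurableSpace 𝓗]
    [MeasurableSpace 𝓓] {P : Measure Ω} [IsProbabilityMeasure P] {H : Ω → 𝓗} {D : Ω → 𝓓}
    (hH : Measurable H) (hD : Measurable D) (hind : IndepFun H D P)
    {φ : 𝓗 → 𝓓 → ℝ≥0∞} (hφ : Measurable (Function.uncurry φ)) :
    ∫⁻ ω, φ (H ω) (D ω) ∂P = ∫⁻ ω, ∫⁻ d, φ (H ω) d ∂(P.map D) ∂P := by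
  have h1 := (indepFun_iff_map_prod_eq_prod_map_map hH.aemeasurable hD.aemeasurable).1 hind
  have := Measure.isProbabilityMeasure_map hD.aemeasurable (μ := P)
  have h2 : ∫⁻ ω, φ (H ω) (D ω) ∂P
      = ∫⁻ z, Function.uncurry φ z ∂(P.map fun ω => (H ω, D ω)) := by
    rw [lintegral_map hφ (hH.prodMk hD)]; rfl
  rw [h2, h1, lintegral_prod _ hφ.aemeasurable,
    lintegral_map (f := fun x => ∫⁻ y, Function.uncurry φ (x, y) ∂(P.map D))
      hφ.lintegral_prod_right' hH]
  rfl

/-- The indicator of `A` is adjoined to `H` as a further past-measurable coordinate, which reduces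
the claim to the unrestricted case. Working in `ℝ≥0∞` avoids integrability conditions. -/
lemma setLIntegral_comp_of_indep {Ω 𝓗 𝓓 : Type*} {m m0 : MeasurableSpace Ω} [MeasurableSpace 𝓗]
    [m𝓓 : MeasurableSpace 𝓓] {P : Measure Ω} [IsProbabilityMeasure P] (hm : m ≤ m0)
    {H : Ω → 𝓗} {D : Ω → 𝓓} {A : Set Ω}
    (hH : Measurable[m] H) (hA : MeasurableSet[m] A) (hD : Measurable D)
    (hind : Indep m (m𝓓.comap D) P)
    {φ : 𝓗 → 𝓓 → ℝ≥0∞} (hφ : Measurable (Function.uncurry φ)) :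
    ∫⁻ ω in A, φ (H ω) (D ω) ∂P = ∫⁻ ω in A, ∫⁻ d, φ (H ω) d ∂(P.map D) ∂P := by
  have := Measure.isProbabilityMeasure_map hD.aemeasurable (μ := P)
  have hI : Measurable[m] (A.indicator (1 : Ω → ℝ≥0∞)) :=
    (@measurable_const _ _ _ m 1).indicator hA
  have hHI : Measurable[m] (fun ω => (H ω, A.indicator (1 : Ω → ℝ≥0∞) ω)) := hH.prodMk hI
  have hi : IndepFun (fun ω => (H ω, A.indicator (1 : Ω → ℝ≥0∞) ω)) D P :=
    (IndepFun_iff_Indep _ _ _).2 (indep_of_indep_of_le_left hind hHI.comap_le)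
  have hφ' : Measurable (Function.uncurry
      fun (z : 𝓗 × ℝ≥0∞) (d : 𝓓) => z.2 * φ z.1 d) := by
    have : Measurable fun z : (𝓗 × ℝ≥0∞) × 𝓓 => Function.uncurry φ (z.1.1, z.2) :=
      hφ.comp (by fun_prop)
    exact (measurable_snd.comp measurable_fst).mul this
  have key := lintegral_comp_of_indepFun (hHI.mono hm le_rfl) hD hi hφ'
  rw [← lintegral_indicator (hm _ hA), ← lintegral_indicator (hm _ hA)]
  convert key using 2
  · ext ω; by_cases h : ω ∈ A <;> simp [h]
  · ext ω; by_cases h : ω ∈ A <;> simp [h]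

/-- Lyapunov data for a stochastic recursion `x ↦ x - a • U y x d` on the region `𝒞`: a function
`L` with differential `L'`, for which the mean field `Λ` is a descent direction with rate `Q`. -/
structure IsLyapunov {E 𝓓 : Type*} [NormedAddCommGroup E] [NormedSpace ℝ E]
    [MeasurableSpace 𝓓] (μ : Measure 𝓓) (𝒞 : Set E) (U : E → E → 𝓓 → E) (Λ : E → E)
    (L : E → ℝ) (L' : E → E →L[ℝ] ℝ) (Q : E → ℝ) (B M Lmax : ℝ) : Prop where
  integrable : ∀ y ∈ 𝒞, ∀ x ∈ 𝒞, Integrable (U y x) μ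
  mean : ∀ y ∈ 𝒞, ∀ x ∈ 𝒞, ∫ d, U y x d ∂μ = Λ x
  integrable_sq : ∀ y ∈ 𝒞, ∀ x ∈ 𝒞, Integrable (fun d => ‖U y x d‖ ^ 2) μ
  second_moment : ∀ y ∈ 𝒞, ∀ x ∈ 𝒞, ∫ d, ‖U y x d‖ ^ 2 ∂μ ≤ B
  nonneg : 0 ≤ M
  -- The bound is required only when the step stays in `𝒞`, since the direction is unbounded and the
  -- iterate may leave.
  upper : ∀ x ∈ 𝒞, ∀ z, x + z ∈ 𝒞 → L (x + z) ≤ L x + L' x z + M * ‖z‖ ^ 2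
  -- For every step, even one that leaves `𝒞`: truncating the model to `ℝ≥0∞` then loses nothing, so
  -- its expectation over all draws can be computed exactly.
  model_nonneg : ∀ x ∈ 𝒞, ∀ z, 0 ≤ L x + L' x z + M * ‖z‖ ^ 2
  descent : ∀ x ∈ 𝒞, Q x ≤ L' x (Λ x)
  rate_nonneg : ∀ x ∈ 𝒞, 0 ≤ Q x
  le_max : ∀ x ∈ 𝒞, L x ≤ Lmax

/-- The event that `X 0, …, X k` all lie in `𝒞`. -/
def stayedIn {E Ω : Type*} (𝒞 : Set E) (X : ℕ → Ω → E) (k : ℕ) : Set Ω := {ω | ∀ j ≤ k, X j ω ∈ 𝒞}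

/-- The information contained in the first `k` draws. -/
@[reducible] def pastDraws {𝓓 Ω : Type*} [m𝓓 : MeasurableSpace 𝓓] (D : ℕ → Ω → 𝓓) (k : ℕ) : MeasurableSpace Ω :=
  ⨆ i ∈ {i : ℕ | i < k}, m𝓓.comap (D i)

lemma pastDraws_mono {𝓓 Ω : Type*} [MeasurableSpace 𝓓] (D : ℕ → Ω → 𝓓) : Monotone (pastDraws D) := fun _ _ h =>
  biSup_mono fun _ hi => lt_of_lt_of_le hi h

lemma pastDraws_le {𝓓 Ω : Type*} [MeasurableSpace 𝓓] [mΩ : MeasurableSpace Ω] {D : ℕ → Ω → 𝓓} (hD : ∀ k, Measurable (D k)) (k : ℕ) :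
    pastDraws D k ≤ mΩ := iSup₂_le fun i _ => (hD i).comap_le

lemma measurable_pastDraws {𝓓 Ω : Type*} [m𝓓 : MeasurableSpace 𝓓] (D : ℕ → Ω → 𝓓) {i k : ℕ} (h : i < k) :
    Measurable[pastDraws D k] (D i) :=
  Measurable.of_comap_le (le_iSup₂_of_le (f := fun i (_ : i ∈ {i : ℕ | i < k}) => m𝓓.comap (D i))
    i h le_rfl)

lemma indep_pastDraws {𝓓 Ω : Type*} [m𝓓 : MeasurableSpace 𝓓] [MeasurableSpace Ω]
    {P : Measure Ω} [IsProbabilityMeasure P] {D : ℕ → Ω → 𝓓}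
    (hD : ∀ k, Measurable (D k)) (hi : iIndepFun D P) (k : ℕ) :
    Indep (pastDraws D k) (m𝓓.comap (D k)) P := by
  have := indep_iSup_of_disjoint (fun i => (hD i).comap_le) hi
    (S := {i : ℕ | i < k}) (T := {k}) (by simp)
  simpa [pastDraws] using this

lemma measurableSet_stayedIn {E Ω : Type*} [MeasurableSpace E] {m : MeasurableSpace Ω}
    {𝒞 : Set E} (h𝒞 : MeasurableSet 𝒞) {X : ℕ → Ω → E}
    {k : ℕ} (hX : ∀ i ≤ k, Measurable[m] (X i)) : MeasurableSet[m] (stayedIn 𝒞 X k) := by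
  have : stayedIn 𝒞 X k = ⋂ i, ⋂ (_ : i ≤ k), X i ⁻¹' 𝒞 := by ext; simp [stayedIn]
  rw [this]
  exact MeasurableSet.iInter fun i => MeasurableSet.iInter fun hi => hX i hi h𝒞

/-! ### Expected decrease in one step and its telescoped sum. -/

section Descent

variable {E 𝓓 Ω : Type*} [NormedAddCommGroup E] [NormedSpace ℝ E]
  [MeasurableSpace 𝓓] {μ : Measure 𝓓} [IsProbabilityMeasure μ]
  {𝒞 : Set E} {U : E → E → 𝓓 → E} {Λ : E → E} {L : E → ℝ} {L' : E → E →L[ℝ] ℝ} {Q : E → ℝ}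
  {B M Lmax : ℝ}

lemma IsLyapunov.integrable_model (h : IsLyapunov μ 𝒞 U Λ L L' Q B M Lmax) (a : ℝ) {x y : E}
    (hy : y ∈ 𝒞) (hx : x ∈ 𝒞) :
    Integrable (fun d => L x + L' x (-(a • U y x d)) + M * ‖-(a • U y x d)‖ ^ 2) μ := by
  refine ((integrable_const _).add ?_).add ?_
  · exact ((L' x).integrable_comp (((h.integrable y hy x hx).smul a).neg))
  · have : (fun d => M * ‖-(a • U y x d)‖ ^ 2) = fun d => (M * a ^ 2) * ‖U y x d‖ ^ 2 := by
      ext d; rw [norm_neg, norm_smul, mul_pow, Real.norm_eq_abs, sq_abs]; ring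
    rw [this]
    exact (h.integrable_sq y hy x hx).const_mul _

lemma IsLyapunov.integral_model_le [CompleteSpace E] (h : IsLyapunov μ 𝒞 U Λ L L' Q B M Lmax)
    {a : ℝ} (ha : 0 ≤ a) {x y : E} (hy : y ∈ 𝒞) (hx : x ∈ 𝒞) :
    ∫ d, (L x + L' x (-(a • U y x d)) + M * ‖-(a • U y x d)‖ ^ 2) ∂μ
      ≤ L x - a * Q x + a ^ 2 * (M * B) := by
  have hU := h.integrable y hy x hx
  have e : ∀ d, L x + L' x (-(a • U y x d)) + M * ‖-(a • U y x d)‖ ^ 2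
      = L x - a * L' x (U y x d) + M * a ^ 2 * ‖U y x d‖ ^ 2 := by
    intro d
    rw [norm_neg, norm_smul, mul_pow, Real.norm_eq_abs, sq_abs, map_neg, map_smul, smul_eq_mul]
    ring
  simp_rw [e]
  have i1 : Integrable (fun d => a * L' x (U y x d)) μ :=
    ((L' x).integrable_comp hU).const_mul a
  have i2 : Integrable (fun d => M * a ^ 2 * ‖U y x d‖ ^ 2) μ :=
    (h.integrable_sq y hy x hx).const_mul _
  have i0 : Integrable (fun d => L x - a * L' x (U y x d)) μ := (integrable_const _).sub i1
  rw [integral_add i0 i2, integral_sub (integrable_const _) i1, integral_const_mul, integral_const_mul, (L' x).integral_comp_comm hU, h.mean y hy x hx]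
  simp only [integral_const, probReal_univ, one_smul]
  have h1 := mul_le_mul_of_nonneg_left (h.descent x hx) ha
  have h2 := mul_le_mul_of_nonneg_left (h.second_moment y hy x hx)
    (mul_nonneg h.nonneg (sq_nonneg a))
  nlinarith

/-- The rate term stands on the left because subtraction in `ℝ≥0∞` truncates. -/
lemma IsLyapunov.lintegral_model_add_le [CompleteSpace E]
    (h : IsLyapunov μ 𝒞 U Λ L L' Q B M Lmax)
    {a : ℝ} (ha : 0 ≤ a) {x y : E} (hy : y ∈ 𝒞) (hx : x ∈ 𝒞) :
    (∫⁻ d, ENNReal.ofReal (L x + L' x (-(a • U y x d)) + M * ‖-(a • U y x d)‖ ^ 2) ∂μ)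
      + ENNReal.ofReal a * ENNReal.ofReal (Q x)
      ≤ ENNReal.ofReal (L x) + ENNReal.ofReal (a ^ 2 * (M * B)) := by
  rw [← ofReal_integral_eq_lintegral_ofReal (h.integrable_model a hy hx)
    (Filter.Eventually.of_forall fun d => h.model_nonneg x hx _), ← ENNReal.ofReal_mul ha,
    ← ENNReal.ofReal_add (integral_nonneg fun d => h.model_nonneg x hx _)
      (mul_nonneg ha (h.rate_nonneg x hx))]
  refine le_trans (ENNReal.ofReal_le_ofReal ?_) ENNReal.ofReal_add_le
  linarith [h.integral_model_le ha hy hx]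

variable [MeasurableSpace E] [BorelSpace E] [SecondCountableTopology E]

lemma measurable_iterates {D : ℕ → Ω → 𝓓} {X : ℕ → Ω → E} {x₀ : E} {α : ℕ → ℝ} {j : ℕ → ℕ}
    (hj : ∀ k, j k ≤ k) (hU : Measurable fun z : (E × E) × 𝓓 => U z.1.1 z.1.2 z.2)
    (h0 : ∀ ω, X 0 ω = x₀)
    -- The induction carries all `i ≤ k` at once, because a step also uses the older reference
    -- iterate `X (j k)`.
    (hstep : ∀ k ω, X (k + 1) ω = X k ω - α k • U (X (j k) ω) (X k ω) (D k ω)) (k : ℕ) :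
    ∀ i ≤ k, Measurable[pastDraws D k] (X i) := by
  induction k with
  | zero =>
    intro i hi
    obtain rfl : i = 0 := by omega
    have : X 0 = fun _ => x₀ := funext h0
    rw [this]; exact measurable_const
  | succ k ih =>
    have ih' : ∀ i ≤ k, Measurable[pastDraws D (k + 1)] (X i) := fun i hi =>
      (ih i hi).mono (pastDraws_mono D k.le_succ) le_rfl
    intro i hi
    rcases Nat.lt_or_eq_of_le hi with h | rfl
    · exact ih' i (by omega)
    · have : X (k + 1) = fun ω => X k ω - α k • U (X (j k) ω) (X k ω) (D k ω) :=
        funext (hstep k)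
      rw [this]
      have h1 := hU.comp (((ih' _ (hj k)).prodMk (ih' _ le_rfl)).prodMk
        (measurable_pastDraws D k.lt_succ_self))
      exact (ih' _ le_rfl).sub (h1.const_smul (α k))

variable [MeasurableSpace Ω]

/-- One step of the descent argument, stopped upon leaving `𝒞`. -/
lemma IsLyapunov.setLIntegral_succ_le [CompleteSpace E] (h : IsLyapunov μ 𝒞 U Λ L L' Q B M Lmax)
    (h𝒞 : MeasurableSet 𝒞) (hL : Measurable L) (hL' : Continuous L') (hQ : Measurable Q)
    (hU : Measurable fun z : (E × E) × 𝓓 => U z.1.1 z.1.2 z.2)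
    {P : Measure Ω} [IsProbabilityMeasure P] {D : ℕ → Ω → 𝓓}
    (hD : ∀ k, Measurable (D k)) (hlaw : ∀ k, P.map (D k) = μ) (hi : iIndepFun D P)
    {X : ℕ → Ω → E} {x₀ : E} {α : ℕ → ℝ} (hα : ∀ k, 0 ≤ α k) {j : ℕ → ℕ} (hj : ∀ k, j k ≤ k)
    (h0 : ∀ ω, X 0 ω = x₀)
    (hstep : ∀ k ω, X (k + 1) ω = X k ω - α k • U (X (j k) ω) (X k ω) (D k ω)) (k : ℕ) :
    (∫⁻ ω in stayedIn 𝒞 X (k + 1), ENNReal.ofReal (L (X (k + 1) ω)) ∂P)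
      + ENNReal.ofReal (α k) * ∫⁻ ω in stayedIn 𝒞 X k, ENNReal.ofReal (Q (X k ω)) ∂P
      ≤ (∫⁻ ω in stayedIn 𝒞 X k, ENNReal.ofReal (L (X k ω)) ∂P)
        + ENNReal.ofReal (α k ^ 2 * (M * B)) := by
  have hXm := measurable_iterates hj hU h0 hstep (D := D)
  have hX : ∀ k, Measurable (X k) := fun k =>
    (hXm k k le_rfl).mono (pastDraws_le hD k) le_rfl
  have hAm := measurableSet_stayedIn h𝒞 (hXm k)
  have hA : MeasurableSet (stayedIn 𝒞 X k) := pastDraws_le hD k _ hAm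
  set φ : E × E → 𝓓 → ℝ≥0∞ := fun z d => ENNReal.ofReal
    (L z.2 + L' z.2 (-(α k • U z.1 z.2 d)) + M * ‖-(α k • U z.1 z.2 d)‖ ^ 2) with hφdef
  have hφ : Measurable (Function.uncurry φ) := by
    have hx : Measurable fun z : (E × E) × 𝓓 => z.1.2 := by fun_prop
    have hz : Measurable fun z : (E × E) × 𝓓 => -(α k • U z.1.1 z.1.2 z.2) :=
      (hU.const_smul (α k)).neg
    have hc : Measurable fun w : E × E => L' w.1 w.2 :=
      ((hL'.comp continuous_fst).clm_apply continuous_snd).measurable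
    exact (((hL.comp hx).add (hc.comp (hx.prodMk hz))).add
      ((hz.norm.pow_const 2).const_mul M)).ennreal_ofReal
  have hsub : stayedIn 𝒞 X (k + 1) ⊆ stayedIn 𝒞 X k := fun ω hω i hi => hω i (by omega)
  -- The quadratic bound holds on the smaller event. Enlarging to the event at time `k`, which is
  -- determined by the past, costs nothing since the integrand lies in `ℝ≥0∞`.
  have s1 : ∫⁻ ω in stayedIn 𝒞 X (k + 1), ENNReal.ofReal (L (X (k + 1) ω)) ∂P
      ≤ ∫⁻ ω in stayedIn 𝒞 X k, φ (X (j k) ω, X k ω) (D k ω) ∂P := by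
    refine le_trans (setLIntegral_mono' (pastDraws_le hD _ _
      (measurableSet_stayedIn h𝒞 (hXm (k + 1)))) fun ω hω => ?_)
      (lintegral_mono_set hsub)
    have e : X (k + 1) ω = X k ω + -(α k • U (X (j k) ω) (X k ω) (D k ω)) := by
      rw [hstep, sub_eq_add_neg]
    have h1 := hω (k + 1) le_rfl
    rw [e] at h1 ⊢
    exact ENNReal.ofReal_le_ofReal (h.upper _ (hω k (by omega)) _ h1)
  -- Both iterates and the event depend on earlier draws only, so the draw `D k` can be integrated
  -- out with these frozen.
  have s2 := setLIntegral_comp_of_indep (P := P) (pastDraws_le hD k)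
    ((hXm k _ (hj k)).prodMk (hXm k k le_rfl)) hAm (hD k) (indep_pastDraws hD hi k) hφ
  rw [hlaw k] at s2
  refine le_trans (add_le_add_left (s1.trans_eq s2) _) ?_
  have mQ : Measurable fun ω => ENNReal.ofReal (Q (X k ω)) := (hQ.comp (hX k)).ennreal_ofReal
  rw [← lintegral_const_mul _ mQ, ← lintegral_add_right _ (mQ.const_mul _)]
  have s3 : ENNReal.ofReal (α k ^ 2 * (M * B)) ≥
      ∫⁻ _ω in stayedIn 𝒞 X k, ENNReal.ofReal (α k ^ 2 * (M * B)) ∂P := by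
    rw [setLIntegral_const]
    exact mul_le_of_le_one_right' prob_le_one
  refine le_trans ?_ (add_le_add_right s3 _)
  rw [← lintegral_add_right _ measurable_const]
  exact setLIntegral_mono' hA fun ω hω =>
    h.lintegral_model_add_le (hα k) (hω _ (hj k)) (hω k le_rfl)

lemma IsLyapunov.sum_le [CompleteSpace E] (h : IsLyapunov μ 𝒞 U Λ L L' Q B M Lmax)
    (h𝒞 : MeasurableSet 𝒞) (hL : Measurable L) (hL' : Continuous L') (hQ : Measurable Q)
    (hU : Measurable fun z : (E × E) × 𝓓 => U z.1.1 z.1.2 z.2)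
    {P : Measure Ω} [IsProbabilityMeasure P] {D : ℕ → Ω → 𝓓}
    (hD : ∀ k, Measurable (D k)) (hlaw : ∀ k, P.map (D k) = μ) (hi : iIndepFun D P)
    {X : ℕ → Ω → E} {x₀ : E} {α : ℕ → ℝ} (hα : ∀ k, 0 ≤ α k) {j : ℕ → ℕ} (hj : ∀ k, j k ≤ k)
    (h0 : ∀ ω, X 0 ω = x₀)
    (hstep : ∀ k ω, X (k + 1) ω = X k ω - α k • U (X (j k) ω) (X k ω) (D k ω)) (n : ℕ) :
    ∑ k ∈ Finset.range n, ENNReal.ofReal (α k) *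
        ∫⁻ ω in stayedIn 𝒞 X k, ENNReal.ofReal (Q (X k ω)) ∂P
      ≤ ENNReal.ofReal Lmax + ∑ k ∈ Finset.range n, ENNReal.ofReal (α k ^ 2 * (M * B)) := by
  have key : ∀ n, (∫⁻ ω in stayedIn 𝒞 X n, ENNReal.ofReal (L (X n ω)) ∂P) +
      ∑ k ∈ Finset.range n, ENNReal.ofReal (α k) *
        ∫⁻ ω in stayedIn 𝒞 X k, ENNReal.ofReal (Q (X k ω)) ∂P
      ≤ ENNReal.ofReal Lmax + ∑ k ∈ Finset.range n, ENNReal.ofReal (α k ^ 2 * (M * B)) := by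
    intro n
    induction n with
    | zero =>
      simp only [Finset.range_zero, Finset.sum_empty, add_zero]
      -- The bound is free of `x₀`: if the start lies outside `𝒞`, the event is empty.
      calc ∫⁻ ω in stayedIn 𝒞 X 0, ENNReal.ofReal (L (X 0 ω)) ∂P
          ≤ ∫⁻ _ω in stayedIn 𝒞 X 0, ENNReal.ofReal Lmax ∂P :=
            setLIntegral_mono measurable_const fun ω hω =>
              ENNReal.ofReal_le_ofReal (h.le_max _ (hω 0 le_rfl))
        _ ≤ ENNReal.ofReal Lmax := by
            rw [setLIntegral_const]
            exact mul_le_of_le_one_right' prob_le_one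
    | succ n ih =>
      rw [Finset.sum_range_succ, Finset.sum_range_succ, ← add_assoc, ← add_assoc]
      calc _ = ((∫⁻ ω in stayedIn 𝒞 X (n + 1), ENNReal.ofReal (L (X (n + 1) ω)) ∂P)
              + ENNReal.ofReal (α n) * ∫⁻ ω in stayedIn 𝒞 X n, ENNReal.ofReal (Q (X n ω)) ∂P)
            + ∑ k ∈ Finset.range n, ENNReal.ofReal (α k) *
              ∫⁻ ω in stayedIn 𝒞 X k, ENNReal.ofReal (Q (X k ω)) ∂P := by
            rw [add_right_comm]
        _ ≤ _ := add_le_add_left (h.setLIntegral_succ_le h𝒞 hL hL' hQ hU hD hlaw hi hα hj h0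
              hstep n) _
        _ = _ := add_right_comm _ _ _
        _ ≤ _ := add_le_add_left ih _
  exact le_trans le_add_self (key n)

/-! ### Sums of the step sizes and the resulting rate. -/

lemma sum_inv_succ_le (K : ℕ) (hK : 1 ≤ K) :
    ∑ k ∈ Finset.range (K + 1), ((k : ℝ) + 1)⁻¹ ≤ 2 * (1 + Real.log K) := by
  have h := harmonic_le_one_add_log (K + 1)
  simp only [harmonic, Rat.cast_sum, Rat.cast_inv] at h
  have hK' : (1 : ℝ) ≤ K := by exact_mod_cast hK
  have h1 : Real.log ((K + 1 : ℕ) : ℝ) ≤ Real.log 2 + Real.log K := by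
    rw [← Real.log_mul (by norm_num) (by positivity)]
    apply Real.log_le_log (by positivity)
    push_cast; linarith
  have h2 : Real.log 2 ≤ 1 := by linarith [Real.log_two_lt_d9]
  have h3 := Real.log_nonneg hK'
  push_cast at h h1
  linarith

/-- Each of the `K + 1` terms is at least the last one, so the sum is at least `√(K + 1)`. -/
lemma sqrt_le_sum_inv_sqrt (K : ℕ) :
    √(K : ℝ) ≤ ∑ k ∈ Finset.range (K + 1), (√((k : ℝ) + 1))⁻¹ := by
  have : ∀ k ∈ Finset.range (K + 1), (√((K : ℝ) + 1))⁻¹ ≤ (√((k : ℝ) + 1))⁻¹ := by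
    intro k hk
    have : (k : ℝ) ≤ K := by exact_mod_cast Nat.lt_succ_iff.1 (Finset.mem_range.1 hk)
    gcongr
  have h := Finset.card_nsmul_le_sum _ _ _ this
  rw [Finset.card_range, nsmul_eq_mul] at h
  refine le_trans ?_ h
  push_cast
  rw [← div_eq_mul_inv, Real.div_sqrt]
  exact Real.sqrt_le_sqrt (by linarith)

/-- The rate of the stochastic descent method with step sizes `α₀ / √(k + 1)`. -/
theorem IsLyapunov.exists_le_rate [CompleteSpace E] (h : IsLyapunov μ 𝒞 U Λ L L' Q B M Lmax)
    (h𝒞 : MeasurableSet 𝒞) (hL : Measurable L) (hL' : Continuous L') (hQ : Measurable Q)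
    (hU : Measurable fun z : (E × E) × 𝓓 => U z.1.1 z.1.2 z.2) (hB : 0 ≤ B) (hLmax : 0 ≤ Lmax)
    {P : Measure Ω} [IsProbabilityMeasure P] {D : ℕ → Ω → 𝓓}
    (hD : ∀ k, Measurable (D k)) (hlaw : ∀ k, P.map (D k) = μ) (hi : iIndepFun D P)
    {X : ℕ → Ω → E} {x₀ : E} {α₀ : ℝ} (hα : 0 < α₀) {j : ℕ → ℕ} (hj : ∀ k, j k ≤ k)
    (h0 : ∀ ω, X 0 ω = x₀)
    (hstep : ∀ k ω, X (k + 1) ω = X k ω -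
      (α₀ / √((k : ℝ) + 1)) • U (X (j k) ω) (X k ω) (D k ω)) (K : ℕ) (hK : 1 ≤ K) :
    ∃ k ≤ K, ∫⁻ ω in stayedIn 𝒞 X k, ENNReal.ofReal (Q (X k ω)) ∂P
      ≤ ENNReal.ofReal ((Lmax + 2 * α₀ ^ 2 * (M * B)) / α₀ * (1 + Real.log K) / √K) := by
  -- One minimizing index bounds every summand from below. Choosing it for `Q` as a whole lets the
  -- same index serve both final estimates.
  obtain ⟨k₀, hk₀, hmin⟩ := Finset.exists_min_image (Finset.range (K + 1))
    (fun k => ∫⁻ ω in stayedIn 𝒞 X k, ENNReal.ofReal (Q (X k ω)) ∂P) ⟨0, by simp⟩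
  refine ⟨k₀, Nat.lt_succ_iff.1 (Finset.mem_range.1 hk₀), ?_⟩
  set q := ∫⁻ ω in stayedIn 𝒞 X k₀, ENNReal.ofReal (Q (X k₀ ω)) ∂P
  have hMB : 0 ≤ M * B := mul_nonneg h.nonneg hB
  have hK' : (1 : ℝ) ≤ K := by exact_mod_cast hK
  have hlog := Real.log_nonneg hK'
  have hs := h.sum_le h𝒞 hL hL' hQ hU hD hlaw hi (α := fun k => α₀ / √((k : ℝ) + 1))
    (fun k => by positivity) hj h0 hstep (K + 1)
  have h1 : ENNReal.ofReal (α₀ * √(K : ℝ)) * q ≤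
      ∑ k ∈ Finset.range (K + 1), ENNReal.ofReal (α₀ / √((k : ℝ) + 1)) *
        ∫⁻ ω in stayedIn 𝒞 X k, ENNReal.ofReal (Q (X k ω)) ∂P := by
    calc ENNReal.ofReal (α₀ * √(K : ℝ)) * q
        ≤ (∑ k ∈ Finset.range (K + 1), ENNReal.ofReal (α₀ / √((k : ℝ) + 1))) * q := by
          rw [← ENNReal.ofReal_sum_of_nonneg fun k _ => by positivity]
          gcongr
          simp_rw [div_eq_mul_inv, ← Finset.mul_sum]
          exact mul_le_mul_of_nonneg_left (sqrt_le_sum_inv_sqrt K) hα.le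
      _ = ∑ k ∈ Finset.range (K + 1), ENNReal.ofReal (α₀ / √((k : ℝ) + 1)) * q :=
          Finset.sum_mul _ _ _
      _ ≤ _ := Finset.sum_le_sum fun k hk => mul_le_mul_right (hmin k hk) _
  have h2 : ENNReal.ofReal Lmax + ∑ k ∈ Finset.range (K + 1),
      ENNReal.ofReal ((α₀ / √((k : ℝ) + 1)) ^ 2 * (M * B))
      ≤ ENNReal.ofReal ((Lmax + 2 * α₀ ^ 2 * (M * B)) * (1 + Real.log K)) := by
    rw [← ENNReal.ofReal_sum_of_nonneg fun k _ => by positivity,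
      ← ENNReal.ofReal_add hLmax (Finset.sum_nonneg fun k _ => by positivity)]
    apply ENNReal.ofReal_le_ofReal
    have e : ∀ k : ℕ, (α₀ / √((k : ℝ) + 1)) ^ 2 * (M * B)
        = α₀ ^ 2 * (M * B) * ((k : ℝ) + 1)⁻¹ := fun k => by
      rw [div_pow, Real.sq_sqrt (by positivity)]; ring
    simp_rw [e, ← Finset.mul_sum]
    have := mul_le_mul_of_nonneg_left (sum_inv_succ_le K hK)
      (mul_nonneg (sq_nonneg α₀) hMB)
    nlinarith [mul_nonneg hLmax hlog]
  have hpos : 0 < α₀ * √(K : ℝ) := by positivity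
  have h3 := h1.trans (hs.trans h2)
  have e : (Lmax + 2 * α₀ ^ 2 * (M * B)) / α₀ * (1 + Real.log K) / √K
      = (Lmax + 2 * α₀ ^ 2 * (M * B)) * (1 + Real.log K) / (α₀ * √(K : ℝ)) := by
    field_simp
  rw [e, ENNReal.ofReal_div_of_pos hpos, ENNReal.le_div_iff_mul_le
    (Or.inl (by simpa using hpos)) (Or.inl ENNReal.ofReal_ne_top), mul_comm]
  exact h3

end Descent

/-! ### Frobenius geometry -/

@[simp] lemma toM_add {n p : ℕ} (X Y : Mat n p) : toM (X + Y) = toM X + toM Y := rfl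
@[simp] lemma toM_sub {n p : ℕ} (X Y : Mat n p) : toM (X - Y) = toM X - toM Y := rfl
@[simp] lemma toM_smul {n p : ℕ} (c : ℝ) (X : Mat n p) : toM (c • X) = c • toM X := rfl
lemma ofM_add {n p : ℕ} (A B : Matrix (Fin n) (Fin p) ℝ) : ofM (A + B) = ofM A + ofM B := rfl
lemma ofM_sub {n p : ℕ} (A B : Matrix (Fin n) (Fin p) ℝ) : ofM (A - B) = ofM A - ofM B := rfl
lemma ofM_smul {n p : ℕ} (c : ℝ) (A : Matrix (Fin n) (Fin p) ℝ) : ofM (c • A) = c • ofM A := rfl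

lemma norm_ofM_sq {n p : ℕ} (A : Matrix (Fin n) (Fin p) ℝ) :
    ‖ofM A‖ ^ 2 = ∑ i, ∑ j, A i j ^ 2 := by
  rw [EuclideanSpace.norm_sq_eq, Fintype.sum_prod_type]
  simp [ofM]

lemma inner_ofM {n p : ℕ} (A B : Matrix (Fin n) (Fin p) ℝ) :
    inner ℝ (ofM A) (ofM B) = (Aᵀ * B).trace := by
  rw [PiLp.inner_apply, Fintype.sum_prod_type, Finset.sum_comm]
  simp [ofM, Matrix.trace, Matrix.mul_apply, mul_comm]

lemma norm_ofM_transpose {n p : ℕ} (A : Matrix (Fin n) (Fin p) ℝ) : ‖ofM Aᵀ‖ = ‖ofM A‖ := by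
  rw [← sq_eq_sq₀ (norm_nonneg _) (norm_nonneg _), norm_ofM_sq, norm_ofM_sq, Finset.sum_comm]
  rfl

lemma norm_ofM_mul_le {n m p : ℕ} (A : Matrix (Fin n) (Fin m) ℝ) (B : Matrix (Fin m) (Fin p) ℝ) :
    ‖ofM (A * B)‖ ≤ ‖ofM A‖ * ‖ofM B‖ := by
  rw [← pow_le_pow_iff_left₀ (norm_nonneg _) (by positivity) two_ne_zero, mul_pow, norm_ofM_sq, norm_ofM_sq, norm_ofM_sq, Finset.sum_comm (f := fun i j => B i j ^ 2),
    Finset.sum_mul_sum]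
  gcongr with i _ j _
  rw [Matrix.mul_apply]
  exact Finset.sum_mul_sq_le_sq_mul_sq _ _ _

lemma norm_ofM_mul_le_of_le {n m p : ℕ} {A : Matrix (Fin n) (Fin m) ℝ}
    {B : Matrix (Fin m) (Fin p) ℝ} {a b : ℝ} (hA : ‖ofM A‖ ≤ a) (hB : ‖ofM B‖ ≤ b) :
    ‖ofM (A * B)‖ ≤ a * b :=
  (norm_ofM_mul_le A B).trans (mul_le_mul hA hB (norm_nonneg _) ((norm_nonneg _).trans hA))

lemma norm_ofM_skewPart_le {n : ℕ} (A : Matrix (Fin n) (Fin n) ℝ) :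
    ‖ofM (skewPart A)‖ ≤ ‖ofM A‖ := by
  rw [skewPart, ofM_smul, ofM_sub, norm_smul]
  have := norm_sub_le (ofM A) (ofM Aᵀ)
  rw [norm_ofM_transpose] at this
  norm_num
  linarith

lemma transpose_skewPart {n : ℕ} (A : Matrix (Fin n) (Fin n) ℝ) :
    (skewPart A)ᵀ = -skewPart A := by
  simp [skewPart, ← smul_neg]

/-- Matrix multiplication as a continuous bilinear map. -/
def mulL (n m p : ℕ) : Mat n m →L[ℝ] Mat m p →L[ℝ] Mat n p :=
  LinearMap.mkContinuous₂
    (LinearMap.mk₂ ℝ (fun X Y => ofM (toM X * toM Y))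
      (fun X X' Y => by simp [Matrix.add_mul, ofM_add])
      (fun c X Y => by simp [ofM_smul])
      (fun X Y Y' => by simp [Matrix.mul_add, ofM_add])
      (fun c X Y => by simp [ofM_smul])) 1
    (fun X Y => by simpa using norm_ofM_mul_le (toM X) (toM Y))

@[simp] lemma mulL_apply {n m p : ℕ} (X : Mat n m) (Y : Mat m p) :
    mulL n m p X Y = ofM (toM X * toM Y) := rfl

/-- Transposition as a continuous linear map. -/
def transposeL (n p : ℕ) : Mat n p →L[ℝ] Mat p n :=
  LinearMap.toContinuousLinearMap
    { toFun := fun X => ofM (toM X)ᵀ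
      map_add' := fun _ _ => rfl
      map_smul' := fun _ _ => rfl }

@[simp] lemma transposeL_apply {n p : ℕ} (X : Mat n p) : transposeL n p X = ofM (toM X)ᵀ := rfl

/-! ### The constraint function -/

/-- The matrix `Xᵀ X - 1`. -/
def gramDefect {n p : ℕ} (X : Mat n p) : Mat p p := ofM ((toM X)ᵀ * toM X - 1)

lemma coe_stiefelConstraint {n p : ℕ} (X : Mat n p) :
    ((stiefelConstraint X : symMat p) : Mat p p) = gramDefect X := rfl

lemma norm_stiefelConstraint {n p : ℕ} (X : Mat n p) : ‖stiefelConstraint X‖ = ‖gramDefect X‖ := rfl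

/-- The differential of `gramDefect`. -/
def gramDefectDeriv {n p : ℕ} (X : Mat n p) : Mat n p →L[ℝ] Mat p p :=
  (mulL p n p (transposeL n p X)) + (mulL p n p).flip X ∘L transposeL n p

lemma gramDefectDeriv_apply {n p : ℕ} (X Z : Mat n p) :
    gramDefectDeriv X Z = ofM ((toM X)ᵀ * toM Z + (toM Z)ᵀ * toM X) := rfl

lemma hasFDerivAt_gramDefect {n p : ℕ} (X : Mat n p) :
    HasFDerivAt (gramDefect (n := n) (p := p)) (gramDefectDeriv X) X := by
  have h := (mulL p n p).hasFDerivAt_of_bilinear (transposeL n p).hasFDerivAt (hasFDerivAt_id X)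
  refine (h.sub_const (ofM 1)).congr_fderiv ?_
  ext1 Z
  simp [gramDefectDeriv]

lemma contDiff_gramDefect {n p : ℕ} {k : WithTop ℕ∞} :
    ContDiff ℝ k (gramDefect (n := n) (p := p)) := by
  have h : ContDiff ℝ k fun X : Mat n p => mulL p n p (transposeL n p X) X :=
    ((mulL p n p).contDiff.comp (transposeL n p).contDiff).clm_apply contDiff_id
  have e : gramDefect (n := n) (p := p) = fun X => mulL p n p (transposeL n p X) X - ofM 1 := rfl
  rw [e]
  exact h.sub contDiff_const

lemma continuous_gramDefect {n p : ℕ} : Continuous (gramDefect (n := n) (p := p)) :=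
  (contDiff_gramDefect (k := 0)).continuous

/-- The diagonal entries of `XᵀX - 1` are the squared column norms minus one, so every squared
column norm is at most `R + 1`. -/
lemma isCompact_safeRegion (n p : ℕ) (R : ℝ) : IsCompact (safeRegion n p R) := by
  have hcl : IsClosed (safeRegion n p R) :=
    isClosed_le continuous_gramDefect.norm continuous_const
  refine Metric.isCompact_of_isClosed_isBounded hcl ?_
  refine (Metric.isBounded_closedBall (x := (0 : Mat n p)) (r := √(∑ _j : Fin p, (R + 1)))).subset
    fun X hX => ?_
  rw [mem_closedBall_zero_iff]
  apply Real.le_sqrt_of_sq_le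
  have h := norm_ofM_sq (toM X)
  rw [ofM_toM, Finset.sum_comm] at h
  rw [h]
  refine Finset.sum_le_sum fun j _ => ?_
  have h1 : |gramDefect X (j, j)| ≤ R := (PiLp.norm_apply_le (gramDefect X) (j, j)).trans hX
  have h2 : gramDefect X (j, j) = ∑ i, toM X i j ^ 2 - 1 := by
    simp [gramDefect, ofM, Matrix.mul_apply, sq]
  rw [h2] at h1
  linarith [le_abs_self (∑ i, toM X i j ^ 2 - 1)]

lemma landingNormal_eq {n p : ℕ} (X : Mat n p) :
    landingNormal X = (2 : ℝ) • mulL n p p X (gramDefect X) := rfl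

/-- The differential of `landingNormal`. -/
def landingNormalDeriv {n p : ℕ} (X : Mat n p) : Mat n p →L[ℝ] Mat n p :=
  (2 : ℝ) • (mulL n p p X ∘L gramDefectDeriv X + (mulL n p p).flip (gramDefect X))

lemma landingNormalDeriv_apply {n p : ℕ} (X Z : Mat n p) :
    landingNormalDeriv X Z = (2 : ℝ) • (ofM (toM X * ((toM X)ᵀ * toM Z + (toM Z)ᵀ * toM X)) +
      ofM (toM Z * toM (gramDefect X))) := rfl

lemma hasFDerivAt_landingNormal {n p : ℕ} (X : Mat n p) :
    HasFDerivAt (landingNormal (n := n) (p := p)) (landingNormalDeriv X) X := by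
  have h := (mulL n p p).hasFDerivAt_of_bilinear (hasFDerivAt_id X) (hasFDerivAt_gramDefect X)
  refine (h.const_smul (2 : ℝ)).congr_fderiv ?_
  ext1 Z
  simp [landingNormalDeriv]

lemma contDiff_landingNormal {n p : ℕ} {k : WithTop ℕ∞} :
    ContDiff ℝ k (landingNormal (n := n) (p := p)) :=
  ((mulL n p p).contDiff.clm_apply contDiff_gramDefect).const_smul (2 : ℝ)

/-- By symmetry of `h(X)` the two summands of `Dh(X)[Z]` have equal traces against it. This
identifies `∇𝒩` as the gradient of `‖h‖²/2`. -/
lemma inner_gramDefect_deriv {n p : ℕ} (X Z : Mat n p) :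
    inner ℝ (gramDefect X) (gramDefectDeriv X Z) = inner ℝ (landingNormal X) Z := by
  have hs : (toM (gramDefect X))ᵀ = toM (gramDefect X) := (stiefelConstraint X).2
  rw [gramDefectDeriv_apply, landingNormal_eq, ← ofM_toM (gramDefect X), inner_ofM, ← ofM_toM Z,
    inner_smul_left, mulL_apply, inner_ofM]
  simp only [toM_ofM, hs, Matrix.mul_add, Matrix.trace_add, Matrix.transpose_mul]
  have : (toM (gramDefect X) * ((toM Z)ᵀ * toM X)).trace
      = (toM (gramDefect X) * ((toM X)ᵀ * toM Z)).trace := by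
    rw [← Matrix.trace_transpose, Matrix.transpose_mul, Matrix.transpose_mul, hs,
      Matrix.transpose_transpose, Matrix.trace_mul_comm]
  rw [this, Matrix.mul_assoc]
  simp; ring

lemma constraintDeriv_apply {n p : ℕ} (X Z : Mat n p) :
    ((constraintDeriv X Z : symMat p) : Mat p p) = gramDefectDeriv X Z := by
  have hd : DifferentiableAt ℝ (stiefelConstraint (n := n) (p := p)) X := by
    -- Differentiability into the subspace comes from the orthogonal projection, which fixes the
    -- already symmetric values of `gramDefect`.
    have h1 : stiefelConstraint (n := n) (p := p)
        = (symMat p).orthogonalProjectionOnto ∘ gramDefect := by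
      ext1 Y
      rw [Function.comp_apply, ← coe_stiefelConstraint]
      simp
    rw [h1]
    exact (ContinuousLinearMap.differentiableAt _).comp X
      (hasFDerivAt_gramDefect X).differentiableAt
  have h2 := ((symMat p).subtypeL.hasFDerivAt.comp X hd.hasFDerivAt).unique
    (hasFDerivAt_gramDefect X)
  exact congrArg (fun l => l Z) h2

lemma adjoint_constraintDeriv {n p : ℕ} (X : Mat n p) :
    LinearMap.adjoint (constraintDeriv X) (stiefelConstraint X) = landingNormal X := by
  refine ext_inner_right ℝ fun Z => ?_
  rw [LinearMap.adjoint_inner_left, ← inner_gramDefect_deriv, ← constraintDeriv_apply]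
  rfl

lemma sigmaMin_mul_norm_le {E F : Type*} [NormedAddCommGroup E] [InnerProductSpace ℝ E]
    [FiniteDimensional ℝ E] [NormedAddCommGroup F] [InnerProductSpace ℝ F] [FiniteDimensional ℝ F]
    (A : E →ₗ[ℝ] F) (y : F) : sigmaMin A * ‖y‖ ≤ ‖LinearMap.adjoint A y‖ := by
  rcases eq_or_ne y 0 with rfl | hy
  · simp
  have hy' := norm_pos_iff.2 hy
  have h : sigmaMin A ≤ ‖LinearMap.adjoint A (‖y‖⁻¹ • y)‖ :=
    ciInf_le (f := fun y : Metric.sphere (0 : F) 1 => ‖LinearMap.adjoint A (y : F)‖)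
      ⟨0, by rintro _ ⟨z, rfl⟩; exact norm_nonneg _⟩
      ⟨‖y‖⁻¹ • y, by simp [norm_smul, hy]⟩
  rw [map_smul, norm_smul, norm_inv, norm_norm, inv_mul_eq_div, le_div_iff₀ hy'] at h
  exact h

/-- Since `∇𝒩(X) = Dh(X)* h(X)`, the singular value hypothesis becomes a gradient domination
inequality for the infeasibility. This is its only use. -/
lemma mul_norm_gramDefect_le {n p : ℕ} {σ : ℝ} {X : Mat n p}
    (h : σ ≤ sigmaMin (constraintDeriv X)) : σ * ‖gramDefect X‖ ≤ ‖landingNormal X‖ := by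
  rw [← adjoint_constraintDeriv, ← norm_stiefelConstraint]
  exact (mul_le_mul_of_nonneg_right h (norm_nonneg _)).trans (sigmaMin_mul_norm_le _ _)

/-! ### The retracted point `X (3 - Xᵀ X) / 2` -/

/-- The Newton step `X (3 - Xᵀ X) / 2` for the polar factor of `X`. -/
def polarStep {n p : ℕ} (X : Mat n p) : Mat n p := X - (1 / 4 : ℝ) • landingNormal X

lemma contDiff_polarStep {n p : ℕ} {k : WithTop ℕ∞} :
    ContDiff ℝ k (polarStep (n := n) (p := p)) :=
  contDiff_id.sub (contDiff_landingNormal.const_smul (1 / 4 : ℝ))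

/-- The differential of `polarStep`. -/
def polarStepDeriv {n p : ℕ} (X : Mat n p) : Mat n p →L[ℝ] Mat n p :=
  ContinuousLinearMap.id ℝ _ - (1 / 4 : ℝ) • landingNormalDeriv X

lemma hasFDerivAt_polarStep {n p : ℕ} (X : Mat n p) :
    HasFDerivAt (polarStep (n := n) (p := p)) (polarStepDeriv X) X :=
  (hasFDerivAt_id X).sub ((hasFDerivAt_landingNormal X).const_smul (1 / 4 : ℝ))

lemma norm_polarStep_sub_le {n p : ℕ} (X : Mat n p) :
    ‖polarStep X - X‖ ≤ ‖X‖ * ‖gramDefect X‖ := by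
  have h := norm_ofM_mul_le (toM X) (toM (gramDefect X))
  have e : polarStep X - X = -((1 / 2 : ℝ) • ofM (toM X * toM (gramDefect X))) := by
    rw [polarStep, landingNormal_eq, mulL_apply, smul_smul]; norm_num
  rw [e, norm_neg, norm_smul]
  simp only [ofM_toM] at h
  norm_num
  nlinarith [norm_nonneg (ofM (toM X * toM (gramDefect X)))]

/-- The factor `1/4` in `polarStep` is what cancels the terms linear in `H = h(X)`: with `XᵀX = 1 +
H`, the derivative is `2XH - XH² - 2X(H + H²)`. -/
lemma polarStepDeriv_landingNormal {n p : ℕ} (X : Mat n p) :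
    polarStepDeriv X (landingNormal X)
      = -(3 : ℝ) • ofM (toM X * (toM (gramDefect X) * toM (gramDefect X))) := by
  have hs : (toM (gramDefect X))ᵀ = toM (gramDefect X) := (stiefelConstraint X).2
  have hX : (toM X)ᵀ * toM X = 1 + toM (gramDefect X) := by simp [gramDefect]
  set H := toM (gramDefect X) with hH
  set M := toM X with hM
  have e1 : toM (landingNormal X) = (2 : ℝ) • (M * H) := rfl
  have e2 : Mᵀ * (M * H) = H + H * H := by rw [← Matrix.mul_assoc, hX, Matrix.add_mul, one_mul]
  have e3 : (M * H)ᵀ * M = H + H * H := by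
    rw [Matrix.transpose_mul, hs, Matrix.mul_assoc, hX, Matrix.mul_add, mul_one]
  change landingNormal X - (1 / 4 : ℝ) • landingNormalDeriv X (landingNormal X) = _
  rw [landingNormalDeriv_apply, e1, ← hH, ← hM, Matrix.transpose_smul, Matrix.mul_smul,
    Matrix.smul_mul, e2, e3, Matrix.smul_mul, Matrix.mul_assoc M H H, landingNormal_eq, mulL_apply,
    ← hH, ← hM]
  simp only [← ofM_smul, ← ofM_add, ← ofM_sub, ← smul_add, Matrix.mul_add, Matrix.mul_smul]
  congr 1
  module

lemma norm_polarStepDeriv_landingNormal_le {n p : ℕ} (X : Mat n p) :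
    ‖polarStepDeriv X (landingNormal X)‖ ≤ 3 * (‖X‖ * ‖gramDefect X‖ ^ 2) := by
  rw [polarStepDeriv_landingNormal, norm_smul, sq]
  norm_num
  exact norm_ofM_mul_le_of_le le_rfl (norm_ofM_mul_le _ _)

/-! ### Tangency of `grad f` and its pairing with `∇f`. -/

lemma transpose_mul_riemGrad {n p : ℕ} (f : Mat n p → ℝ) (X : Mat n p) :
    (toM X)ᵀ * toM (riemGrad f X) + (toM (riemGrad f X))ᵀ * toM X = 0 := by
  simp only [riemGrad, toM_ofM, Matrix.transpose_smul, Matrix.transpose_mul, transpose_skewPart,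
    Matrix.mul_smul, Matrix.smul_mul, ← smul_add, Matrix.mul_assoc, Matrix.neg_mul,
    Matrix.mul_neg, add_neg_cancel, smul_zero]

lemma gramDefectDeriv_riemGrad {n p : ℕ} (f : Mat n p → ℝ) (X : Mat n p) :
    gramDefectDeriv X (riemGrad f X) = 0 := by
  rw [gramDefectDeriv_apply, transpose_mul_riemGrad]; rfl

/-- As `Dh(X)[grad f(X)] = 0`, only the outer factor `X` of `X h(X)` is differentiated, leaving the
error `-grad f(X) h(X)/2`. -/
lemma norm_polarStepDeriv_riemGrad_sub_le {n p : ℕ} (f : Mat n p → ℝ) (X : Mat n p) :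
    ‖polarStepDeriv X (riemGrad f X) - riemGrad f X‖ ≤ ‖riemGrad f X‖ * ‖gramDefect X‖ := by
  have h := norm_ofM_mul_le (toM (riemGrad f X)) (toM (gramDefect X))
  have e : polarStepDeriv X (riemGrad f X) - riemGrad f X
      = -((1 / 2 : ℝ) • ofM (toM (riemGrad f X) * toM (gramDefect X))) := by
    change riemGrad f X - (1 / 4 : ℝ) • landingNormalDeriv X (riemGrad f X) - riemGrad f X = _
    rw [landingNormalDeriv_apply, transpose_mul_riemGrad, Matrix.mul_zero,
      show (ofM (0 : Matrix (Fin n) (Fin p) ℝ)) = 0 from rfl]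
    module
  rw [e, norm_neg, norm_smul]
  simp only [ofM_toM] at h
  norm_num
  nlinarith [norm_nonneg (ofM (toM (riemGrad f X) * toM (gramDefect X)))]

lemma inner_landingNormal_riemGrad {n p : ℕ} (f : Mat n p → ℝ) (X : Mat n p) :
    inner ℝ (landingNormal X) (riemGrad f X) = 0 := by
  rw [← inner_gramDefect_deriv, gramDefectDeriv_riemGrad, inner_zero_right]

lemma norm_riemGrad_le {n p : ℕ} (f : Mat n p → ℝ) (X : Mat n p) :
    ‖riemGrad f X‖ ≤ 2 * (‖ofM (skewPart (toM (gradient f X) * (toM X)ᵀ))‖ * ‖X‖) := by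
  rw [riemGrad, ofM_smul, norm_smul]
  norm_num
  exact norm_ofM_mul_le_of_le le_rfl le_rfl

/-- Moving `X` across the trace pairs `∇f Xᵀ` with its own skew part, and a skew matrix sees only
the skew part of the other factor. -/
lemma inner_gradient_riemGrad {n p : ℕ} (f : Mat n p → ℝ) (X : Mat n p) :
    inner ℝ (gradient f X) (riemGrad f X)
      = 2 * ‖ofM (skewPart (toM (gradient f X) * (toM X)ᵀ))‖ ^ 2 := by
  set g := toM (gradient f X) with hg
  set M := toM X with hM
  set A := skewPart (g * Mᵀ) with hA
  have h1 : inner ℝ (gradient f X) (riemGrad f X) = 2 * (gᵀ * (A * M)).trace := by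
    rw [riemGrad, ofM_smul, inner_smul_right, ← ofM_toM (gradient f X), inner_ofM]
    simp only [toM_ofM, ← hg, ← hM, ← hA]
  have h2 : (gᵀ * (A * M)).trace = (M * gᵀ * A).trace := by
    rw [← Matrix.mul_assoc, Matrix.trace_mul_comm, Matrix.mul_assoc]
  have h3 : (M * gᵀ * A).trace = -(g * Mᵀ * A).trace := by
    rw [← Matrix.trace_transpose, Matrix.transpose_mul, Matrix.transpose_mul,
      Matrix.transpose_transpose, hA, transpose_skewPart, Matrix.trace_mul_comm]
    simp
  have h4 : ‖ofM A‖ ^ 2 = -(A * A).trace := by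
    rw [← real_inner_self_eq_norm_sq, inner_ofM, hA, transpose_skewPart]; simp
  have h5 : (A * A).trace = 1 / 2 * ((g * Mᵀ * A).trace - (M * gᵀ * A).trace) := by
    conv_lhs => enter [1, 1]; rw [hA, skewPart]
    simp [Matrix.sub_mul, Matrix.transpose_mul]
  rw [h1, h4, h5, h2, h3]; ring

lemma norm_sq_riemGrad_le {n p : ℕ} (f : Mat n p → ℝ) {X : Mat n p} {ρ : ℝ} (hX : ‖X‖ ≤ ρ) :
    ‖riemGrad f X‖ ^ 2 ≤ 2 * ρ ^ 2 * inner ℝ (gradient f X) (riemGrad f X) := by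
  rw [inner_gradient_riemGrad]
  set a := ‖ofM (skewPart (toM (gradient f X) * (toM X)ᵀ))‖
  have h : ‖riemGrad f X‖ ≤ 2 * (a * ρ) := (norm_riemGrad_le f X).trans (by gcongr)
  calc ‖riemGrad f X‖ ^ 2 ≤ (2 * (a * ρ)) ^ 2 := by gcongr
    _ = _ := by ring

/-! ### The merit function -/

lemma exists_forall_norm_le {E G : Type*} [TopologicalSpace E] [NormedAddCommGroup G]
    {K : Set E} (hK : IsCompact K) {F : E → G} (hF : Continuous F) :
    ∃ C, 0 ≤ C ∧ ∀ x ∈ K, ‖F x‖ ≤ C := by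
  obtain ⟨C, hC⟩ := hK.exists_bound_of_continuousOn hF.continuousOn
  exact ⟨|C|, abs_nonneg _, fun x hx => (hC x hx).trans (le_abs_self C)⟩

lemma exists_lipschitz_closedBall {E G : Type*} [NormedAddCommGroup E] [NormedSpace ℝ E]
    [ProperSpace E] [NormedAddCommGroup G] [NormedSpace ℝ G] {F : E → G} (hF : ContDiff ℝ 1 F)
    (ρ : ℝ) : ∃ ℓ, 0 ≤ ℓ ∧ ∀ x y, ‖x‖ ≤ ρ → ‖y‖ ≤ ρ → ‖F y - F x‖ ≤ ℓ * ‖y - x‖ := by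
  obtain ⟨ℓ, h0, hℓ⟩ := exists_forall_norm_le (isCompact_closedBall (0 : E) ρ)
    (hF.continuous_fderiv one_ne_zero)
  refine ⟨ℓ, h0, fun x y hx hy => (convex_closedBall (0 : E) ρ).norm_image_sub_le_of_norm_fderiv_le
    (fun z _ => (hF.differentiable one_ne_zero) z) hℓ ?_ ?_⟩ <;> simpa

lemma exists_quadratic_upper_bound {E : Type*} [NormedAddCommGroup E] [NormedSpace ℝ E]
    [ProperSpace E] {L : E → ℝ} (hL : ContDiff ℝ 2 L) (ρ : ℝ) :
    ∃ M, 0 ≤ M ∧ ∀ x z, ‖x‖ ≤ ρ → ‖x + z‖ ≤ ρ →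
      L (x + z) ≤ L x + fderiv ℝ L x z + M * ‖z‖ ^ 2 := by
  obtain ⟨M, h0, hM⟩ := exists_lipschitz_closedBall
    (hL.fderiv_right (m := 1) (by norm_num [one_add_one_eq_two])) ρ
  refine ⟨M, h0, fun x z hx hz => ?_⟩
  -- The safe region need not be convex, so the mean value inequality is applied in a ball.
  have hseg : segment ℝ x (x + z) ⊆ Metric.closedBall 0 ρ :=
    (convex_closedBall (0 : E) ρ).segment_subset (by simpa) (by simpa)
  have h := (convex_segment x (x + z)).norm_image_sub_le_of_norm_hasFDerivWithin_le'
    (f := L) (f' := fderiv ℝ L) (φ := fderiv ℝ L x) (C := M * ‖z‖)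
    (fun w _ => ((hL.differentiable two_ne_zero) w).hasFDerivAt.hasFDerivWithinAt)
    (fun w hw => by
      refine (hM x w hx (by simpa using hseg hw)).trans ?_
      gcongr
      simpa using norm_sub_le_of_mem_segment hw)
    (left_mem_segment ℝ _ _) (right_mem_segment ℝ _ _)
  rw [add_sub_cancel_left, Real.norm_eq_abs] at h
  have := (abs_le.1 h).2
  nlinarith

/-- The merit function `f ∘ polarStep + (μ / 2) ‖h‖²`, up to the constant `b`. -/
def merit {n p : ℕ} (f : Mat n p → ℝ) (μ b : ℝ) (X : Mat n p) : ℝ :=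
  f (polarStep X) + μ / 2 * ‖gramDefect X‖ ^ 2 + b

lemma contDiff_merit {n p : ℕ} {f : Mat n p → ℝ} {k : WithTop ℕ∞} (hf : ContDiff ℝ k f)
    (μ b : ℝ) : ContDiff ℝ k (merit f μ b) :=
  ((hf.comp contDiff_polarStep).add
    (contDiff_const.mul (contDiff_gramDefect.norm_sq ℝ))).add contDiff_const

lemma fderiv_merit_apply {n p : ℕ} {f : Mat n p → ℝ} (hf : Differentiable ℝ f) (μ b : ℝ)
    (X Z : Mat n p) : fderiv ℝ (merit f μ b) X Z =
      fderiv ℝ f (polarStep X) (polarStepDeriv X Z) + μ * inner ℝ (landingNormal X) Z := by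
  have h1 := (hf (polarStep X)).hasFDerivAt.comp X (hasFDerivAt_polarStep X)
  have h2 := (hasFDerivAt_gramDefect X).norm_sq.const_mul (μ / 2)
  have h3 : HasFDerivAt (merit f μ b) _ X := (h1.add h2).add_const b
  rw [h3.fderiv, ← inner_gramDefect_deriv]
  simp
  ring

/-- The landing field `ω_T grad f + ω_N ∇𝒩`. -/
def landingField {n p : ℕ} (f : Mat n p → ℝ) (ωT ωN : ℝ) (X : Mat n p) : Mat n p :=
  ωT • riemGrad f X + ωN • landingNormal X

lemma fderiv_merit_landingField_ge {n p : ℕ} {f : Mat n p → ℝ} (hf : Differentiable ℝ f)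
    {ωT ωN σ ρ β ℓ μ : ℝ} (hωT : 0 < ωT) (hωN : 0 < ωN) (hσ : 0 < σ) (hρ : 0 < ρ)
    (hℓ : 0 ≤ ℓ) (hμ : 0 ≤ μ) (b : ℝ) {X : Mat n p}
    (hX : ‖X‖ ≤ ρ) (hβ : ‖fderiv ℝ f (polarStep X)‖ ≤ β)
    (hlip : ‖fderiv ℝ f (polarStep X) - fderiv ℝ f X‖ ≤ ℓ * ‖polarStep X - X‖)
    (hV : σ * ‖gramDefect X‖ ≤ ‖landingNormal X‖) :
    ωT * ((2 * ρ ^ 2)⁻¹ * ‖riemGrad f X‖ ^ 2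
        - (ℓ * ρ + β) * ‖gramDefect X‖ * ‖riemGrad f X‖)
      + (μ * ωN * σ ^ 2 - ωN * (3 * β * ρ)) * ‖gramDefect X‖ ^ 2
      ≤ fderiv ℝ (merit f μ b) X (landingField f ωT ωN X) := by
  set x := ‖riemGrad f X‖ with hx
  set y := ‖gramDefect X‖ with hy
  have hx0 : 0 ≤ x := norm_nonneg _
  have hy0 : 0 ≤ y := norm_nonneg _
  have hβ0 : 0 ≤ β := (norm_nonneg _).trans hβ
  have hgrad : fderiv ℝ f X (riemGrad f X) = inner ℝ (gradient f X) (riemGrad f X) := by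
    simp [gradient]
  have t1 : (2 * ρ ^ 2)⁻¹ * x ^ 2 ≤ fderiv ℝ f X (riemGrad f X) := by
    rw [hgrad, inv_mul_le_iff₀ (by positivity)]
    exact norm_sq_riemGrad_le f hX
  have t2 : |(fderiv ℝ f (polarStep X) - fderiv ℝ f X) (riemGrad f X)| ≤ ℓ * (ρ * y) * x := by
    refine ((fderiv ℝ f (polarStep X) - fderiv ℝ f X).le_of_opNorm_le (hlip.trans ?_) _)
    gcongr
    exact (norm_polarStep_sub_le X).trans (by gcongr)
  have t3 : |fderiv ℝ f (polarStep X) (polarStepDeriv X (riemGrad f X) - riemGrad f X)|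
      ≤ β * (x * y) :=
    ((fderiv ℝ f (polarStep X)).le_of_opNorm_le_of_le hβ
      (norm_polarStepDeriv_riemGrad_sub_le f X))
  have t4 : |fderiv ℝ f (polarStep X) (polarStepDeriv X (landingNormal X))|
      ≤ β * (3 * (ρ * y ^ 2)) :=
    ((fderiv ℝ f (polarStep X)).le_of_opNorm_le_of_le hβ
      ((norm_polarStepDeriv_landingNormal_le X).trans (by gcongr)))
  have t5 : (σ * y) ^ 2 ≤ ‖landingNormal X‖ ^ 2 := by gcongr
  -- The derivative is compared with `Df(X)[grad f]`: one error from evaluating `Df` at `polarStep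
  -- X`, one from differentiating `polarStep`. The penalty has no tangential contribution because
  -- `∇𝒩` is orthogonal to `grad f`.
  have e : fderiv ℝ (merit f μ b) X (landingField f ωT ωN X) =
      ωT * (fderiv ℝ f X (riemGrad f X)
        + (fderiv ℝ f (polarStep X) - fderiv ℝ f X) (riemGrad f X)
        + fderiv ℝ f (polarStep X) (polarStepDeriv X (riemGrad f X) - riemGrad f X))
      + ωN * fderiv ℝ f (polarStep X) (polarStepDeriv X (landingNormal X))
      + μ * ωN * ‖landingNormal X‖ ^ 2 := by
    rw [fderiv_merit_apply hf, landingField, inner_add_right, inner_smul_right, inner_smul_right,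
      inner_landingNormal_riemGrad, real_inner_self_eq_norm_sq]
    simp only [map_add, map_smul, map_sub, smul_eq_mul, sub_apply]
    ring
  rw [e]
  have u1 : (2 * ρ ^ 2)⁻¹ * x ^ 2 - (ℓ * ρ + β) * y * x ≤ fderiv ℝ f X (riemGrad f X)
        + (fderiv ℝ f (polarStep X) - fderiv ℝ f X) (riemGrad f X)
        + fderiv ℝ f (polarStep X) (polarStepDeriv X (riemGrad f X) - riemGrad f X) := by
    have := (abs_le.1 t2).1
    have := (abs_le.1 t3).1
    linarith
  have u2 := mul_le_mul_of_nonneg_left (abs_le.1 t4).1 hωN.le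
  have u3 := mul_le_mul_of_nonneg_left t5 (mul_nonneg hμ hωN.le)
  have u4 := mul_le_mul_of_nonneg_left u1 hωT.le
  linarith

lemma exists_merit_descent {n p : ℕ} {f : Mat n p → ℝ} (hf : ContDiff ℝ 2 f) {ωT ωN σ R : ℝ}
    (hωT : 0 < ωT) (hωN : 0 < ωN) (hσ : 0 < σ)
    (hsafe : ∀ X ∈ safeRegion n p R, σ ≤ sigmaMin (constraintDeriv X)) :
    -- The offset `b` does not affect the derivative, so it may be fixed after `μ` and `c`.
    ∃ μ c, 0 < c ∧ ∀ b, ∀ X ∈ safeRegion n p R,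
      c * (‖riemGrad f X‖ ^ 2 + ‖gramDefect X‖ ^ 2)
        ≤ fderiv ℝ (merit f μ b) X (landingField f ωT ωN X) := by
  have hK := isCompact_safeRegion n p R
  have hdf : ContDiff ℝ 1 (fderiv ℝ f) :=
    hf.fderiv_right (m := 1) (by norm_num [one_add_one_eq_two])
  have hq : Continuous (polarStep (n := n) (p := p)) := (contDiff_polarStep (k := 0)).continuous
  obtain ⟨ρ₁, hρ₁, hXρ₁⟩ := exists_forall_norm_le hK (continuous_id (X := Mat n p))
  obtain ⟨ρ₂, hρ₂, hXρ₂⟩ := exists_forall_norm_le hK hq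
  obtain ⟨β, hβ0, hβ⟩ := exists_forall_norm_le hK (hdf.continuous.comp hq)
  obtain ⟨ℓ, hℓ0, hℓ⟩ := exists_lipschitz_closedBall hdf (ρ₁ + ρ₂ + 1)
  set ρ := ρ₁ + ρ₂ + 1 with hρdef
  have hρ : 0 < ρ := by positivity
  set a := (2 * ρ ^ 2)⁻¹ with ha
  have ha0 : 0 < a := by positivity
  set t := ℓ * ρ + β with ht
  have ht0 : 0 ≤ t := by positivity
  set d := 3 * β * ρ with hd
  have hd0 : 0 ≤ d := by positivity
  -- Chosen so that the coefficient of `‖h‖²` is exactly `1` after the Young term and the normal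
  -- error are subtracted. Young takes half of the coefficient `ωT * a` of `‖grad f‖²`.
  set μ := (ωT * (t ^ 2 / (2 * a)) + ωN * d + 1) / (ωN * σ ^ 2) with hμdef
  have hμ0 : 0 ≤ μ := by positivity
  have hμ : μ * ωN * σ ^ 2 = ωT * (t ^ 2 / (2 * a)) + ωN * d + 1 := by
    rw [hμdef]; field_simp
  refine ⟨μ, min (ωT * (a / 2)) 1, by positivity, fun b X hX => ?_⟩
  have h1 : ‖X‖ ≤ ρ := (hXρ₁ X hX).trans (by linarith)
  have h2 : ‖polarStep X‖ ≤ ρ := (hXρ₂ X hX).trans (by linarith)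
  refine le_trans ?_ (fderiv_merit_landingField_ge (hf.differentiable two_ne_zero) hωT hωN hσ hρ
    hℓ0 hμ0 b h1 (hβ X hX) (hℓ X _ h1 h2) (mul_norm_gramDefect_le (hsafe X hX)))
  set x := ‖riemGrad f X‖
  set y := ‖gramDefect X‖
  rw [hμ, ← ha, ← ht, ← hd]
  have young : t * y * x ≤ a / 2 * x ^ 2 + t ^ 2 / (2 * a) * y ^ 2 := by
    have e : a / 2 * x ^ 2 + t ^ 2 / (2 * a) * y ^ 2 - t * y * x
        = (a * x - t * y) ^ 2 / (2 * a) := by field_simp; ring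
    have : 0 ≤ (a * x - t * y) ^ 2 / (2 * a) := by positivity
    linarith
  have u := mul_le_mul_of_nonneg_left young hωT.le
  have m1 := mul_le_mul_of_nonneg_right (min_le_left (ωT * (a / 2)) 1) (sq_nonneg x)
  have m2 := mul_le_mul_of_nonneg_right (min_le_right (ωT * (a / 2)) 1) (sq_nonneg y)
  linarith

/-- A merit function on the safe region with all the properties that the descent argument uses. -/
theorem exists_lyapunov {n p : ℕ} {f : Mat n p → ℝ} (hf : ContDiff ℝ 2 f) {ωT ωN σ R : ℝ}
    (hωT : 0 < ωT) (hωN : 0 < ωN) (hσ : 0 < σ)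
    (hsafe : ∀ X ∈ safeRegion n p R, σ ≤ sigmaMin (constraintDeriv X)) :
    ∃ (L : Mat n p → ℝ) (c M Lmax : ℝ), ContDiff ℝ 2 L ∧ 0 < c ∧ 0 ≤ M ∧ 0 ≤ Lmax ∧
      (∀ X ∈ safeRegion n p R, ∀ Z, X + Z ∈ safeRegion n p R →
        L (X + Z) ≤ L X + fderiv ℝ L X Z + M * ‖Z‖ ^ 2) ∧
      (∀ X ∈ safeRegion n p R, ∀ Z, 0 ≤ L X + fderiv ℝ L X Z + M * ‖Z‖ ^ 2) ∧
      (∀ X ∈ safeRegion n p R, c * (‖riemGrad f X‖ ^ 2 + ‖gramDefect X‖ ^ 2)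
        ≤ fderiv ℝ L X (landingField f ωT ωN X)) ∧
      ∀ X ∈ safeRegion n p R, L X ≤ Lmax := by
  have hK := isCompact_safeRegion n p R
  obtain ⟨μ, c, hc, hdesc⟩ := exists_merit_descent hf hωT hωN hσ hsafe
  obtain ⟨b, -, hb⟩ := exists_forall_norm_le hK (contDiff_merit hf μ 0).continuous
  have hL := contDiff_merit hf μ (b + 1)
  have hsplit : ∀ X, merit f μ (b + 1) X = merit f μ 0 X + (b + 1) := fun X => by
    simp [merit]
  have hlow : ∀ X ∈ safeRegion n p R, 1 ≤ merit f μ (b + 1) X := fun X hX => by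
    rw [hsplit]; linarith [(abs_le.1 (hb X hX)).1]
  obtain ⟨ρ, -, hρ⟩ := exists_forall_norm_le hK (continuous_id (X := Mat n p))
  obtain ⟨m, hm0, hm⟩ := exists_quadratic_upper_bound hL ρ
  obtain ⟨B, hB0, hB⟩ := exists_forall_norm_le hK (hL.continuous_fderiv two_ne_zero)
  obtain ⟨Lm, hLm0, hLm⟩ := exists_forall_norm_le hK hL.continuous
  -- The offset `b + 1` makes `L ≥ 1` on the safe region. Adding `B²` to `m` then gives
  -- nonnegativity of the model, as `1 - B‖Z‖ + B²‖Z‖² ≥ 0`.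
  refine ⟨merit f μ (b + 1), c, m + B ^ 2, Lm, hL, hc, by positivity, hLm0, ?_, ?_, hdesc _, ?_⟩
  · intro X hX Z hZ
    have := hm X Z (hρ X hX) (hρ _ hZ)
    nlinarith [mul_nonneg (sq_nonneg B) (sq_nonneg ‖Z‖)]
  · intro X hX Z
    have h1 := hlow X hX
    have h2 := (abs_le.1 ((fderiv ℝ (merit f μ (b + 1)) X).le_of_opNorm_le (hB X hX) Z)).1
    nlinarith [sq_nonneg (B * ‖Z‖ - 1), mul_nonneg hm0 (sq_nonneg ‖Z‖)]
  · exact fun X hX => (le_abs_self _).trans (hLm X hX)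

/-! ### Moments of the sketched directions -/

lemma enorm_sq_eq_ofReal {E : Type*} [SeminormedAddCommGroup E] (x : E) :
    ‖x‖ₑ ^ 2 = ENNReal.ofReal (‖x‖ ^ 2) := by
  rw [ENNReal.ofReal_pow (norm_nonneg x), ofReal_norm]

lemma integrable_norm_sq_of_lintegral_lt_top {α E : Type*} [MeasurableSpace α]
    [NormedAddCommGroup E] {μ : Measure α} {u : α → E} (hu : AEStronglyMeasurable u μ)
    (h : ∫⁻ a, ‖u a‖ₑ ^ 2 ∂μ < ∞) : Integrable (fun a => ‖u a‖ ^ 2) μ := by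
  refine ⟨hu.norm.pow 2, ?_⟩
  rw [hasFiniteIntegral_iff_ofReal (Filter.Eventually.of_forall fun a => sq_nonneg _)]
  simp_rw [← enorm_sq_eq_ofReal]
  exact h

lemma integral_norm_sq_le_of_lintegral_le {α E : Type*} [MeasurableSpace α]
    [NormedAddCommGroup E] {μ : Measure α} {u : α → E} (hu : AEStronglyMeasurable u μ) {V : ℝ≥0}
    (h : ∫⁻ a, ‖u a‖ₑ ^ 2 ∂μ ≤ V) : ∫ a, ‖u a‖ ^ 2 ∂μ ≤ V := by
  rw [integral_eq_lintegral_of_nonneg_ae (Filter.Eventually.of_forall fun a => sq_nonneg _)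
    (hu.norm.pow 2)]
  simp_rw [← enorm_sq_eq_ofReal]
  exact ENNReal.toReal_le_coe_of_le_coe h

lemma norm_sq_le_two_mul {E : Type*} [SeminormedAddCommGroup E] (x y : E) :
    ‖x‖ ^ 2 ≤ 2 * ‖x - y‖ ^ 2 + 2 * ‖y‖ ^ 2 := by
  have h : ‖x‖ ≤ ‖x - y‖ + ‖y‖ := by simpa using norm_add_le (x - y) y
  have h2 : ‖x‖ ^ 2 ≤ (‖x - y‖ + ‖y‖) ^ 2 := by gcongr
  nlinarith [sq_nonneg (‖x - y‖ - ‖y‖)]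

lemma integrable_norm_sq_of_sub_const {α E : Type*} [MeasurableSpace α]
    [NormedAddCommGroup E] {μ : Measure α} [IsFiniteMeasure μ] {u : α → E} {c : E}
    (hu : AEStronglyMeasurable u μ) (h : Integrable (fun a => ‖u a - c‖ ^ 2) μ) :
    Integrable (fun a => ‖u a‖ ^ 2) μ := by
  refine ((h.const_mul 2).add (integrable_const (2 * ‖c‖ ^ 2))).mono' (hu.norm.pow 2)
    (Filter.Eventually.of_forall fun a => ?_)
  rw [Real.norm_eq_abs, abs_of_nonneg (sq_nonneg _)]
  exact norm_sq_le_two_mul _ _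

lemma integrable_of_integrable_norm_sq {α E : Type*} [MeasurableSpace α]
    [NormedAddCommGroup E] {μ : Measure α} [IsFiniteMeasure μ] {u : α → E}
    (hu : AEStronglyMeasurable u μ) (h : Integrable (fun a => ‖u a‖ ^ 2) μ) : Integrable u μ :=
  ((memLp_two_iff_integrable_sq_norm hu).2 h).integrable one_le_two

lemma IsLinearMap.integral_comp_comm {α E F : Type*} [MeasurableSpace α] {μ : Measure α}
    [NormedAddCommGroup E] [NormedSpace ℝ E] [FiniteDimensional ℝ E]
    [NormedAddCommGroup F] [NormedSpace ℝ F] [CompleteSpace F]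
    {φ : E → F} (hφ : IsLinearMap ℝ φ) {u : α → E} (hu : Integrable u μ) :
    ∫ a, φ (u a) ∂μ = φ (∫ a, u a ∂μ) :=
  have : CompleteSpace E := FiniteDimensional.complete ℝ E
  (LinearMap.toContinuousLinearMap (IsLinearMap.mk' φ hφ)).integral_comp_comm hu

lemma continuous_toM {n p : ℕ} : Continuous (toM : Mat n p → Matrix (Fin n) (Fin p) ℝ) :=
  continuous_matrix fun i j => PiLp.continuous_apply 2 _ (i, j)

lemma continuous_ofM {n p : ℕ} : Continuous (ofM : Matrix (Fin n) (Fin p) ℝ → Mat n p) :=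
  (PiLp.continuous_toLp 2 _).comp
    (continuous_pi fun ij => continuous_id.matrix_elem ij.1 ij.2)

lemma continuous_skewPart {n : ℕ} : Continuous (skewPart (n := n)) :=
  (continuous_id.sub continuous_id.matrix_transpose).const_smul (1 / 2 : ℝ)

lemma continuous_sketchProj {n r : ℕ} : Continuous (sketchProj (n := n) (r := r)) :=
  continuous_toM.matrix_mul continuous_toM.matrix_transpose

lemma continuous_sketchTangent {n p r : ℕ} :
    Continuous fun z : Mat n r × Mat n r × Mat n p × Mat n p =>
      sketchTangent z.1 z.2.1 z.2.2.1 z.2.2.2 := by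
  have h1 := continuous_sketchProj.comp (continuous_fst (X := Mat n r)
    (Y := Mat n r × Mat n p × Mat n p))
  have h2 := continuous_sketchProj.comp ((continuous_fst (X := Mat n r)
    (Y := Mat n p × Mat n p)).comp (continuous_snd (X := Mat n r)))
  have h3 := continuous_toM.comp ((continuous_fst (X := Mat n p) (Y := Mat n p)).comp
    ((continuous_snd (X := Mat n r)).comp (continuous_snd (X := Mat n r))))
  have h4 := continuous_toM.comp ((continuous_snd (X := Mat n p) (Y := Mat n p)).comp
    ((continuous_snd (X := Mat n r)).comp (continuous_snd (X := Mat n r))))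
  exact continuous_ofM.comp ((((continuous_skewPart.comp
    ((h3.matrix_mul h4.matrix_transpose).matrix_mul h1)).matrix_mul h2).matrix_mul h4).const_smul
      (2 : ℝ))

lemma continuous_sketchNormal {n p r : ℕ} :
    Continuous fun z : Mat n r × Mat n r × Mat n p => sketchNormal z.1 z.2.1 z.2.2 := by
  have h1 := continuous_sketchProj.comp (continuous_fst (X := Mat n r) (Y := Mat n r × Mat n p))
  have h2 := continuous_sketchProj.comp ((continuous_fst (X := Mat n r)
    (Y := Mat n p)).comp (continuous_snd (X := Mat n r)))
  have h4 := continuous_toM.comp ((continuous_snd (X := Mat n r) (Y := Mat n p)).comp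
    (continuous_snd (X := Mat n r)))
  exact continuous_ofM.comp (((h2.matrix_mul h4).matrix_mul
    (((h4.matrix_transpose.matrix_mul h1).matrix_mul h4).sub continuous_const)).const_smul (2 : ℝ))

lemma norm_sketchTangent_le {n p r : ℕ} (S S' : Mat n r) (g X : Mat n p) :
    ‖sketchTangent S S' g X‖
      ≤ 2 * (‖g‖ * ‖X‖ * ‖ofM (sketchProj S)‖ * ‖ofM (sketchProj S')‖ * ‖X‖) := by
  rw [sketchTangent, ofM_smul, norm_smul]
  norm_num
  refine norm_ofM_mul_le_of_le (norm_ofM_mul_le_of_le ((norm_ofM_skewPart_le _).trans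
    (norm_ofM_mul_le_of_le (norm_ofM_mul_le_of_le le_rfl ?_) le_rfl)) le_rfl) le_rfl
  rw [norm_ofM_transpose]; rfl

lemma norm_sketchNormal_le {n p r : ℕ} (S S' : Mat n r) (X : Mat n p) :
    ‖sketchNormal S S' X‖ ≤ 2 * (‖ofM (sketchProj S')‖ * ‖X‖ *
      (‖X‖ * ‖ofM (sketchProj S)‖ * ‖X‖ + ‖ofM (1 : Matrix (Fin p) (Fin p) ℝ)‖)) := by
  rw [sketchNormal, ofM_smul, norm_smul]
  norm_num
  refine norm_ofM_mul_le_of_le (norm_ofM_mul_le_of_le le_rfl le_rfl) ?_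
  rw [ofM_sub]
  refine (norm_sub_le _ _).trans (add_le_add_left ?_ _)
  refine norm_ofM_mul_le_of_le (norm_ofM_mul_le_of_le ?_ le_rfl) le_rfl
  rw [norm_ofM_transpose]; rfl

/-- The sketched landing direction `ω_T d_T(X) + ω_N d_N(X)` for the draw `d = (S, S', ξ)`. -/
def sketchDir {n p r : ℕ} {Ξ : Type*} (G : Ξ → Mat n p → Mat n p) (ωT ωN : ℝ) (X : Mat n p)
    (d : Mat n r × Mat n r × Ξ) : Mat n p :=
  ωT • sketchTangent d.1 d.2.1 (G d.2.2 X) X + ωN • sketchNormal d.1 d.2.1 X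

/-- A weight that dominates the squares of the sketched directions. -/
def drawWeight {n p r : ℕ} {Ξ : Type*} (G : Ξ → Mat n p → Mat n p) (X : Mat n p)
    (d : Mat n r × Mat n r × Ξ) : ℝ :=
  (1 + ‖ofM (sketchProj d.1)‖ ^ 2) * ((1 + ‖ofM (sketchProj d.2.1)‖ ^ 2) * (1 + ‖G d.2.2 X‖ ^ 2))

section Moments

variable {n p r : ℕ} {Ξ : Type*} {G : Ξ → Mat n p → Mat n p} {X : Mat n p} {ρ : ℝ}

lemma norm_sq_sketchTangent_le (hX : ‖X‖ ≤ ρ) (d : Mat n r × Mat n r × Ξ) :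
    ‖sketchTangent d.1 d.2.1 (G d.2.2 X) X‖ ^ 2 ≤ 4 * ρ ^ 4 * drawWeight G X d := by
  have hρ : 0 ≤ ρ := (norm_nonneg X).trans hX
  have h := norm_sketchTangent_le d.1 d.2.1 (G d.2.2 X) X
  rw [drawWeight]
  set a := ‖ofM (sketchProj d.1)‖
  set b := ‖ofM (sketchProj d.2.1)‖
  set g := ‖G d.2.2 X‖
  calc _ ≤ (2 * (g * ρ * a * b * ρ)) ^ 2 := by
        refine pow_le_pow_left₀ (norm_nonneg _) (h.trans ?_) 2
        gcongr
    _ = 4 * ρ ^ 4 * (a ^ 2 * (b ^ 2 * g ^ 2)) := by ring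
    _ ≤ _ := by gcongr <;> linarith

lemma norm_sq_sketchNormal_le (hX : ‖X‖ ≤ ρ) (d : Mat n r × Mat n r × Ξ) :
    ‖sketchNormal d.1 d.2.1 X‖ ^ 2 ≤ 8 * ρ ^ 2 *
      (ρ ^ 4 + ‖ofM (1 : Matrix (Fin p) (Fin p) ℝ)‖ ^ 2) * drawWeight G X d := by
  have hρ : 0 ≤ ρ := (norm_nonneg X).trans hX
  have h := norm_sketchNormal_le d.1 d.2.1 X
  rw [drawWeight]
  set a := ‖ofM (sketchProj d.1)‖
  set b := ‖ofM (sketchProj d.2.1)‖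
  set g := ‖G d.2.2 X‖
  set e := ‖ofM (1 : Matrix (Fin p) (Fin p) ℝ)‖
  calc _ ≤ (2 * (b * ρ * (ρ * a * ρ + e))) ^ 2 := by
        refine pow_le_pow_left₀ (norm_nonneg _) (h.trans ?_) 2
        gcongr
    _ = 4 * ρ ^ 2 * (b ^ 2 * (ρ ^ 2 * a + e) ^ 2) := by ring
    -- Cauchy–Schwarz for `(ρ², e)` and `(a, 1)`, with a factor `2` to spare.
    _ ≤ 4 * ρ ^ 2 * (b ^ 2 * (2 * ((ρ ^ 4 + e ^ 2) * (1 + a ^ 2)))) := by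
        gcongr
        nlinarith [sq_nonneg (ρ ^ 2 * a - e), sq_nonneg (e * a), sq_nonneg (ρ ^ 2)]
    _ = 8 * ρ ^ 2 * (ρ ^ 4 + e ^ 2) * ((1 + a ^ 2) * (b ^ 2 * 1)) := by ring
    _ ≤ _ := by gcongr <;> nlinarith [sq_nonneg g]

lemma norm_sq_sketchDir_le (ωT ωN : ℝ) (hX : ‖X‖ ≤ ρ) (d : Mat n r × Mat n r × Ξ) :
    ‖sketchDir G ωT ωN X d‖ ^ 2 ≤ (2 * ωT ^ 2 * (4 * ρ ^ 4) + 2 * ωN ^ 2 * (8 * ρ ^ 2 *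
      (ρ ^ 4 + ‖ofM (1 : Matrix (Fin p) (Fin p) ℝ)‖ ^ 2))) * drawWeight G X d := by
  have h := norm_sq_le_two_mul (sketchDir G ωT ωN X d) (ωN • sketchNormal d.1 d.2.1 X)
  have e : sketchDir G ωT ωN X d - ωN • sketchNormal d.1 d.2.1 X
      = ωT • sketchTangent d.1 d.2.1 (G d.2.2 X) X := by simp [sketchDir]
  rw [e, norm_smul, norm_smul, mul_pow, mul_pow, Real.norm_eq_abs, Real.norm_eq_abs, sq_abs,
    sq_abs] at h
  have h1 := mul_le_mul_of_nonneg_left (norm_sq_sketchTangent_le (G := G) hX d) (sq_nonneg ωT)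
  have h2 := mul_le_mul_of_nonneg_left (norm_sq_sketchNormal_le (G := G) hX d) (sq_nonneg ωN)
  linarith

variable [MeasurableSpace Ξ] {f : Mat n p → ℝ} {𝒞 : Set (Mat n p)} {π : Measure Ξ}
  {ν : Measure (Mat n r)}

lemma measurable_ofM_sketchProj : Measurable fun S : Mat n r => ofM (sketchProj S) :=
  (continuous_ofM.comp continuous_sketchProj).measurable

lemma IsSketchLaw.integrable_norm_sq (hν : IsSketchLaw ν) :
    Integrable (fun S => ‖ofM (sketchProj S)‖ ^ 2) ν := by
  have := hν.isProbabilityMeasure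
  have hm := (measurable_ofM_sketchProj (n := n) (r := r)).aestronglyMeasurable (μ := ν)
  refine integrable_norm_sq_of_sub_const (c := ofM 1) hm ?_
  exact integrable_norm_sq_of_lintegral_lt_top (hm.sub aestronglyMeasurable_const)
    hν.finite_variance

lemma IsSketchLaw.integrable (hν : IsSketchLaw ν) :
    Integrable (fun S => ofM (sketchProj S)) ν :=
  have := hν.isProbabilityMeasure
  integrable_of_integrable_norm_sq measurable_ofM_sketchProj.aestronglyMeasurable
    hν.integrable_norm_sq

lemma IsSketchLaw.integral_eq (hν : IsSketchLaw ν) : ∫ S, ofM (sketchProj S) ∂ν = ofM 1 := by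
  ext ij
  have h := (EuclideanSpace.proj (𝕜 := ℝ) ij : Mat n n →L[ℝ] ℝ).integral_comp_comm hν.integrable
  exact h.symm.trans (hν.unbiased ij.1 ij.2)

lemma IsStochGrad.measurable_apply (hG : IsStochGrad f 𝒞 π G) (X : Mat n p) :
    Measurable fun ξ => G ξ X :=
  hG.measurable.comp (measurable_id.prodMk measurable_const)

lemma IsStochGrad.integrable_norm_sq (hG : IsStochGrad f 𝒞 π G) (hX : X ∈ 𝒞) :
    Integrable (fun ξ => ‖G ξ X‖ ^ 2) π := by
  have := hG.isProbabilityMeasure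
  obtain ⟨V, hV⟩ := hG.bounded_variance
  have hm := (hG.measurable_apply X).aestronglyMeasurable (μ := π)
  exact integrable_norm_sq_of_sub_const hm (integrable_norm_sq_of_lintegral_lt_top
    (hm.sub aestronglyMeasurable_const) ((hV X hX).trans_lt ENNReal.coe_lt_top))

lemma IsStochGrad.exists_second_moment_le (hG : IsStochGrad f 𝒞 π G) {γ : ℝ}
    (hγ : ∀ X ∈ 𝒞, ‖gradient f X‖ ≤ γ) :
    ∃ V, 0 ≤ V ∧ ∀ X ∈ 𝒞, ∫ ξ, ‖G ξ X‖ ^ 2 ∂π ≤ V := by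
  have := hG.isProbabilityMeasure
  obtain ⟨V, hV⟩ := hG.bounded_variance
  refine ⟨2 * V + 2 * γ ^ 2, by positivity, fun X hX => ?_⟩
  have hm : AEStronglyMeasurable (fun ξ => G ξ X - gradient f X) π :=
    (hG.measurable_apply X).aestronglyMeasurable.sub aestronglyMeasurable_const
  have hi := integrable_norm_sq_of_lintegral_lt_top hm ((hV X hX).trans_lt ENNReal.coe_lt_top)
  calc ∫ ξ, ‖G ξ X‖ ^ 2 ∂π
      ≤ ∫ ξ, (2 * ‖G ξ X - gradient f X‖ ^ 2 + 2 * γ ^ 2) ∂π := by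
        refine integral_mono (hG.integrable_norm_sq hX)
          ((hi.const_mul 2).add (integrable_const _)) fun ξ => ?_
        refine (norm_sq_le_two_mul _ (gradient f X)).trans ?_
        have := hγ X hX
        gcongr
    _ = 2 * (∫ ξ, ‖G ξ X - gradient f X‖ ^ 2 ∂π) + 2 * γ ^ 2 := by
        rw [integral_add (hi.const_mul 2) (integrable_const _), integral_const_mul]
        simp
    _ ≤ _ := by
        have := integral_norm_sq_le_of_lintegral_le hm (hV X hX)
        linarith

lemma integrable_drawWeight (hν : IsSketchLaw ν) (hG : IsStochGrad f 𝒞 π G) (hX : X ∈ 𝒞) :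
    Integrable (drawWeight G X) (ν.prod (ν.prod π)) := by
  have := hν.isProbabilityMeasure
  have := hG.isProbabilityMeasure
  have h1 := (integrable_const (1 : ℝ)).add hν.integrable_norm_sq
  have h2 := (integrable_const (1 : ℝ)).add (hG.integrable_norm_sq hX)
  exact h1.mul_prod (h1.mul_prod h2)

/-- The weight is a product of functions of the independent `S`, `S'`, `ξ`. Hence second moments of
`SSᵀ` suffice, although the directions multiply two sketch matrices. -/
lemma integral_drawWeight (hν : IsSketchLaw ν) (hG : IsStochGrad f 𝒞 π G) (hX : X ∈ 𝒞) :
    ∫ d, drawWeight G X d ∂(ν.prod (ν.prod π)) =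
      (1 + ∫ S, ‖ofM (sketchProj S)‖ ^ 2 ∂ν) * ((1 + ∫ S, ‖ofM (sketchProj S)‖ ^ 2 ∂ν) *
        (1 + ∫ ξ, ‖G ξ X‖ ^ 2 ∂π)) := by
  have := hν.isProbabilityMeasure
  have := hG.isProbabilityMeasure
  have e1 : ∫ S, (1 + ‖ofM (sketchProj S)‖ ^ 2) ∂ν = 1 + ∫ S, ‖ofM (sketchProj S)‖ ^ 2 ∂ν := by
    rw [integral_add (integrable_const _) hν.integrable_norm_sq]; simp
  have e2 : ∫ ξ, (1 + ‖G ξ X‖ ^ 2) ∂π = 1 + ∫ ξ, ‖G ξ X‖ ^ 2 ∂π := by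
    rw [integral_add (integrable_const _) (hG.integrable_norm_sq hX)]; simp
  unfold drawWeight
  rw [integral_prod_mul (fun S => 1 + ‖ofM (sketchProj S)‖ ^ 2)
    (fun z : Mat n r × Ξ => (1 + ‖ofM (sketchProj z.1)‖ ^ 2) * (1 + ‖G z.2 X‖ ^ 2)),
    integral_prod_mul (fun S => 1 + ‖ofM (sketchProj S)‖ ^ 2) (fun ξ => 1 + ‖G ξ X‖ ^ 2), e1, e2]

end Moments

/-! ### Unbiasedness of the sketched directions. -/

section Moments

variable {n p r : ℕ} {Ξ : Type*} {G : Ξ → Mat n p → Mat n p} {X : Mat n p} {ρ : ℝ}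
variable [MeasurableSpace Ξ] {f : Mat n p → ℝ} {𝒞 : Set (Mat n p)} {π : Measure Ξ}
  {ν : Measure (Mat n r)}

lemma skewPart_add (A B : Matrix (Fin n) (Fin n) ℝ) :
    skewPart (A + B) = skewPart A + skewPart B := by
  simp only [skewPart, Matrix.transpose_add]; module

lemma skewPart_smul (c : ℝ) (A : Matrix (Fin n) (Fin n) ℝ) :
    skewPart (c • A) = c • skewPart A := by
  simp only [skewPart, Matrix.transpose_smul]; module

/-- The sketched tangent component as a function of the matrices `S Sᵀ` and `S' S'ᵀ`. -/
def tangentMap (X : Mat n p) (P P' : Mat n n) (g : Mat n p) : Mat n p :=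
  ofM ((2 : ℝ) • (skewPart (toM g * (toM X)ᵀ * toM P) * toM P' * toM X))

lemma isLinearMap_tangentMap_grad (X : Mat n p) (P P' : Mat n n) :
    IsLinearMap ℝ (fun g => tangentMap X P P' g) :=
  ⟨fun g g' => by simp [tangentMap, Matrix.add_mul, skewPart_add, ofM_add],
    fun c g => by simp [tangentMap, skewPart_smul, ofM_smul, smul_comm c]⟩

lemma isLinearMap_tangentMap_right (X : Mat n p) (P : Mat n n) (g : Mat n p) :
    IsLinearMap ℝ (fun P' => tangentMap X P P' g) :=
  ⟨fun P' P'' => by simp [tangentMap, Matrix.add_mul, Matrix.mul_add, ofM_add],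
    fun c P' => by simp [tangentMap, ofM_smul, smul_comm c]⟩

lemma isLinearMap_tangentMap_left (X : Mat n p) (P' : Mat n n) (g : Mat n p) :
    IsLinearMap ℝ (fun P => tangentMap X P P' g) :=
  ⟨fun P P'' => by simp [tangentMap, Matrix.add_mul, Matrix.mul_add, skewPart_add, ofM_add],
    fun c P' => by simp [tangentMap, skewPart_smul, ofM_smul, smul_comm c]⟩

lemma sketchTangent_eq (S S' : Mat n r) (g X : Mat n p) :
    sketchTangent S S' g X = tangentMap X (ofM (sketchProj S)) (ofM (sketchProj S')) g := rfl

lemma tangentMap_one (X : Mat n p) :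
    tangentMap X (ofM 1) (ofM 1) (gradient f X) = riemGrad f X := by
  simp [tangentMap, riemGrad]

/-- The part of the sketched normal component that is bilinear in `S Sᵀ` and `S' S'ᵀ`. -/
def normalMap (X : Mat n p) (P P' : Mat n n) : Mat n p :=
  ofM ((2 : ℝ) • (toM P' * toM X * ((toM X)ᵀ * toM P * toM X)))

lemma isLinearMap_normalMap_right (X : Mat n p) (P : Mat n n) :
    IsLinearMap ℝ (fun P' => normalMap X P P') :=
  ⟨fun P' P'' => by simp [normalMap, Matrix.add_mul, ofM_add],
    fun c P' => by simp [normalMap, ofM_smul, smul_comm c]⟩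

lemma isLinearMap_normalMap_left (X : Mat n p) (P' : Mat n n) :
    IsLinearMap ℝ (fun P => normalMap X P P') :=
  ⟨fun P P'' => by simp [normalMap, Matrix.add_mul, Matrix.mul_add, ofM_add],
    fun c P' => by simp [normalMap, ofM_smul, smul_comm c]⟩

lemma sketchNormal_eq (S S' : Mat n r) (X : Mat n p) :
    sketchNormal S S' X = normalMap X (ofM (sketchProj S)) (ofM (sketchProj S'))
      - (2 : ℝ) • mulL n n p (ofM (sketchProj S')) X := by
  rw [mulL_apply, ← ofM_smul, normalMap, ← ofM_sub, ← smul_sub]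
  simp only [sketchNormal, toM_ofM, Matrix.mul_sub, Matrix.mul_one]

lemma normalMap_one (X : Mat n p) :
    normalMap X (ofM 1) (ofM 1) - (2 : ℝ) • mulL n n p (ofM 1) X = landingNormal X := by
  rw [mulL_apply, ← ofM_smul, normalMap, ← ofM_sub, ← smul_sub]
  simp [landingNormal, Matrix.mul_sub]

attribute [local irreducible] tangentMap normalMap sketchTangent sketchNormal

lemma measurable_sketchTangent (hG : Measurable (Function.uncurry G)) :
    Measurable fun z : Mat n p × Mat n r × Mat n r × Ξ =>
      sketchTangent z.2.1 z.2.2.1 (G z.2.2.2 z.1) z.1 := by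
  have h1 : Measurable fun z : Mat n p × Mat n r × Mat n r × Ξ => G z.2.2.2 z.1 :=
    Measurable.comp (g := Function.uncurry G)
      (f := fun z : Mat n p × Mat n r × Mat n r × Ξ => (z.2.2.2, z.1)) hG (by fun_prop)
  have h2 : Measurable fun z : Mat n p × Mat n r × Mat n r × Ξ =>
      (z.2.1, z.2.2.1, G z.2.2.2 z.1, z.1) :=
    (measurable_fst.comp measurable_snd).prodMk
      (((measurable_fst.comp measurable_snd).comp measurable_snd).prodMk (h1.prodMk measurable_fst))
  exact Measurable.comp (g := fun z : Mat n r × Mat n r × Mat n p × Mat n p =>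
    sketchTangent z.1 z.2.1 z.2.2.1 z.2.2.2) continuous_sketchTangent.measurable h2

lemma measurable_sketchNormal :
    Measurable fun z : Mat n p × Mat n r × Mat n r × Ξ => sketchNormal z.2.1 z.2.2.1 z.1 :=
  Measurable.comp (g := fun z : Mat n r × Mat n r × Mat n p => sketchNormal z.1 z.2.1 z.2.2)
    (f := fun z : Mat n p × Mat n r × Mat n r × Ξ => (z.2.1, z.2.2.1, z.1))
    continuous_sketchNormal.measurable (by fun_prop)

lemma measurable_sketchDir (hG : Measurable (Function.uncurry G)) (ωT ωN : ℝ) :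
    Measurable fun z : Mat n p × Mat n r × Mat n r × Ξ => sketchDir G ωT ωN z.1 z.2 := by
  have h1 := (measurable_sketchTangent (r := r) hG).const_smul ωT
  have h2 := (measurable_sketchNormal (n := n) (p := p) (r := r) (Ξ := Ξ)).const_smul ωN
  exact h1.add h2

lemma integrable_norm_sq_of_le_drawWeight (hν : IsSketchLaw ν) (hG : IsStochGrad f 𝒞 π G)
    (hX : X ∈ 𝒞) {u : Mat n r × Mat n r × Ξ → Mat n p} (hu : Measurable u) {c : ℝ}
    (h : ∀ d, ‖u d‖ ^ 2 ≤ c * drawWeight G X d) :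
    Integrable (fun d => ‖u d‖ ^ 2) (ν.prod (ν.prod π)) :=
  ((integrable_drawWeight hν hG hX).const_mul c).mono' (hu.norm.pow_const 2).aestronglyMeasurable
    (Filter.Eventually.of_forall fun d => by
      rw [Real.norm_eq_abs, abs_of_nonneg (sq_nonneg _)]; exact h d)

lemma integrable_of_le_drawWeight (hν : IsSketchLaw ν) (hG : IsStochGrad f 𝒞 π G)
    (hX : X ∈ 𝒞) {u : Mat n r × Mat n r × Ξ → Mat n p} (hu : Measurable u) {c : ℝ}
    (h : ∀ d, ‖u d‖ ^ 2 ≤ c * drawWeight G X d) : Integrable u (ν.prod (ν.prod π)) :=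
  have := hν.isProbabilityMeasure
  have := hG.isProbabilityMeasure
  integrable_of_integrable_norm_sq hu.aestronglyMeasurable
    (integrable_norm_sq_of_le_drawWeight hν hG hX hu h)

lemma integrable_sketchTangent (hν : IsSketchLaw ν) (hG : IsStochGrad f 𝒞 π G) (hX : X ∈ 𝒞) :
    Integrable (fun d : Mat n r × Mat n r × Ξ => sketchTangent d.1 d.2.1 (G d.2.2 X) X)
      (ν.prod (ν.prod π)) :=
  integrable_of_le_drawWeight hν hG hX
    ((measurable_sketchTangent hG.measurable).comp (measurable_const.prodMk measurable_id))
    (norm_sq_sketchTangent_le le_rfl)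

lemma integrable_sketchNormal (hν : IsSketchLaw ν) (hG : IsStochGrad f 𝒞 π G) (hX : X ∈ 𝒞) :
    Integrable (fun d : Mat n r × Mat n r × Ξ => sketchNormal d.1 d.2.1 X)
      (ν.prod (ν.prod π)) :=
  integrable_of_le_drawWeight hν hG hX
    (measurable_sketchNormal.comp (measurable_const.prodMk measurable_id))
    (norm_sq_sketchNormal_le (G := G) le_rfl)

/-- Fubini and linearity in one argument at a time: averaging over `ξ`, then `S'`, then `S` replaces
these by `∇f(X)`, `1` and `1`. -/
lemma integral_sketchTangent (hν : IsSketchLaw ν) (hG : IsStochGrad f 𝒞 π G) (hX : X ∈ 𝒞) :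
    ∫ d, sketchTangent d.1 d.2.1 (G d.2.2 X) X ∂(ν.prod (ν.prod π)) = riemGrad f X := by
  have := hν.isProbabilityMeasure
  have := hG.isProbabilityMeasure
  have hi := integrable_sketchTangent (r := r) hν hG hX
  rw [integral_prod _ hi]
  have h1 : ∀ᵐ S ∂ν, ∫ z : Mat n r × Ξ, sketchTangent S z.1 (G z.2 X) X ∂(ν.prod π)
      = tangentMap X (ofM (sketchProj S)) (ofM 1) (gradient f X) := by
    filter_upwards [hi.prod_right_ae] with S hS
    rw [integral_prod _ hS]
    have h2 : ∀ S', ∫ ξ, sketchTangent S S' (G ξ X) X ∂π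
        = tangentMap X (ofM (sketchProj S)) (ofM (sketchProj S')) (gradient f X) := fun S' => by
      rw [← hG.unbiased X]
      simp_rw [sketchTangent_eq]
      exact IsLinearMap.integral_comp_comm (isLinearMap_tangentMap_grad _ _ _) (hG.integrable X)
    simp_rw [h2]
    rw [← hν.integral_eq]
    exact IsLinearMap.integral_comp_comm (isLinearMap_tangentMap_right _ _ _) hν.integrable
  rw [integral_congr_ae h1,
    IsLinearMap.integral_comp_comm (isLinearMap_tangentMap_left _ _ _) hν.integrable,
    hν.integral_eq, tangentMap_one]

/-- The direction is affine in `SSᵀ`, so the bilinear part and the part linear in `S'S'ᵀ` alone are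
averaged separately. -/
lemma integral_sketchNormal (hν : IsSketchLaw ν) (hG : IsStochGrad f 𝒞 π G) (hX : X ∈ 𝒞) :
    ∫ d, sketchNormal d.1 d.2.1 X ∂(ν.prod (ν.prod π)) = landingNormal X := by
  have := hν.isProbabilityMeasure
  have := hG.isProbabilityMeasure
  have hi := integrable_sketchNormal (r := r) hν hG hX
  rw [integral_prod _ hi]
  have h1 : ∀ᵐ S ∂ν, ∫ z : Mat n r × Ξ, sketchNormal S z.1 X ∂(ν.prod π)
      = normalMap X (ofM (sketchProj S)) (ofM 1) - (2 : ℝ) • mulL n n p (ofM 1) X := by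
    filter_upwards [hi.prod_right_ae] with S hS
    rw [integral_prod _ hS]
    simp only [integral_const, probReal_univ, one_smul, sketchNormal_eq]
    have l := isLinearMap_normalMap_right X (ofM (sketchProj S))
    have i1 : Integrable (fun S' : Mat n r =>
        normalMap X (ofM (sketchProj S)) (ofM (sketchProj S'))) ν :=
      (LinearMap.toContinuousLinearMap (IsLinearMap.mk' _ l)).integrable_comp hν.integrable
    have i2 : Integrable (fun S' : Mat n r =>
        (2 : ℝ) • (mulL n n p).flip X (ofM (sketchProj S'))) ν :=
      (((mulL n n p).flip X).integrable_comp hν.integrable).smul (2 : ℝ)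
    have h2 : ∫ S', (mulL n n p).flip X (ofM (sketchProj S')) ∂ν
        = (mulL n n p).flip X (ofM 1) := by
      rw [((mulL n n p).flip X).integral_comp_comm hν.integrable, hν.integral_eq]
    simp_rw [← ContinuousLinearMap.flip_apply (mulL n n p)]
    rw [integral_sub i1 i2, IsLinearMap.integral_comp_comm l hν.integrable, hν.integral_eq,
      integral_smul, h2]
  have l := isLinearMap_normalMap_left X (ofM 1)
  have i3 : Integrable (fun S : Mat n r => normalMap X (ofM (sketchProj S)) (ofM 1)) ν :=
    (LinearMap.toContinuousLinearMap (IsLinearMap.mk' _ l)).integrable_comp hν.integrable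
  rw [integral_congr_ae h1, integral_sub i3 (integrable_const _),
    IsLinearMap.integral_comp_comm l hν.integrable, hν.integral_eq]
  simp only [integral_const, probReal_univ, one_smul]
  exact normalMap_one X

lemma integrable_sketchDir (hν : IsSketchLaw ν) (hG : IsStochGrad f 𝒞 π G) (hX : X ∈ 𝒞)
    (ωT ωN : ℝ) : Integrable (sketchDir G ωT ωN X) (ν.prod (ν.prod π)) :=
  ((integrable_sketchTangent hν hG hX).smul ωT).add ((integrable_sketchNormal hν hG hX).smul ωN)

lemma integral_sketchDir (hν : IsSketchLaw ν) (hG : IsStochGrad f 𝒞 π G) (hX : X ∈ 𝒞)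
    (ωT ωN : ℝ) :
    ∫ d, sketchDir G ωT ωN X d ∂(ν.prod (ν.prod π)) = landingField f ωT ωN X := by
  unfold sketchDir
  have h := integral_add ((integrable_sketchTangent (r := r) hν hG hX).smul ωT)
    ((integrable_sketchNormal (r := r) hν hG hX).smul ωN)
  simp only [Pi.smul_apply] at h
  rw [h, integral_smul, integral_smul, integral_sketchTangent hν hG hX,
    integral_sketchNormal hν hG hX, landingField]

lemma integrable_norm_sq_sketchDir (hν : IsSketchLaw ν) (hG : IsStochGrad f 𝒞 π G) (hX : X ∈ 𝒞)
    (ωT ωN : ℝ) : Integrable (fun d => ‖sketchDir G ωT ωN X d‖ ^ 2) (ν.prod (ν.prod π)) :=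
  integrable_norm_sq_of_le_drawWeight hν hG hX
    ((measurable_sketchDir hG.measurable ωT ωN).comp (measurable_const.prodMk measurable_id))
    (norm_sq_sketchDir_le ωT ωN le_rfl)

lemma exists_integral_norm_sq_sketchDir_le (hν : IsSketchLaw ν) (hG : IsStochGrad f 𝒞 π G)
    {ρ γ : ℝ} (hρ : ∀ X ∈ 𝒞, ‖X‖ ≤ ρ) (hγ : ∀ X ∈ 𝒞, ‖gradient f X‖ ≤ γ) (ωT ωN : ℝ) :
    ∃ B, 0 ≤ B ∧ ∀ X ∈ 𝒞, ∫ d, ‖sketchDir G ωT ωN X d‖ ^ 2 ∂(ν.prod (ν.prod π)) ≤ B := by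
  obtain ⟨V, hV0, hV⟩ := hG.exists_second_moment_le hγ
  set m := ∫ S, ‖ofM (sketchProj S)‖ ^ 2 ∂ν with hm
  have hm0 : 0 ≤ m := integral_nonneg fun _ => sq_nonneg _
  refine ⟨(2 * ωT ^ 2 * (4 * ρ ^ 4) + 2 * ωN ^ 2 * (8 * ρ ^ 2 *
    (ρ ^ 4 + ‖ofM (1 : Matrix (Fin p) (Fin p) ℝ)‖ ^ 2))) * ((1 + m) * ((1 + m) * (1 + V))),
    by positivity, fun X hX => ?_⟩
  refine (integral_mono (integrable_norm_sq_sketchDir hν hG hX ωT ωN)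
    ((integrable_drawWeight hν hG hX).const_mul _)
    (norm_sq_sketchDir_le ωT ωN (hρ X hX))).trans ?_
  rw [integral_const_mul, integral_drawWeight hν hG hX, ← hm]
  have := hV X hX
  gcongr

end Moments

/-! ### The two methods as stochastic descent methods -/

lemma continuous_gradient {n p : ℕ} {f : Mat n p → ℝ} (hf : ContDiff ℝ 1 f) :
    Continuous (gradient f) :=
  (InnerProductSpace.toDual ℝ (Mat n p)).symm.continuous.comp
    (hf.continuous_fderiv one_ne_zero)

lemma continuous_riemGrad {n p : ℕ} {f : Mat n p → ℝ} (hf : ContDiff ℝ 1 f) :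
    Continuous (riemGrad f) := by
  have h := continuous_toM.comp (continuous_gradient hf)
  exact continuous_ofM.comp (((continuous_skewPart.comp
    (h.matrix_mul continuous_toM.matrix_transpose)).matrix_mul continuous_toM).const_smul (2 : ℝ))

lemma continuous_landingField {n p : ℕ} {f : Mat n p → ℝ} (hf : ContDiff ℝ 1 f) (ωT ωN : ℝ) :
    Continuous (landingField f ωT ωN) :=
  ((continuous_riemGrad hf).const_smul ωT).add
    ((contDiff_landingNormal (k := 0)).continuous.const_smul ωN)

/-- The SVRG direction at `x` with reference point `y`. -/
def svrgDir {n p r : ℕ} {Ξ : Type*} (f : Mat n p → ℝ) (G : Ξ → Mat n p → Mat n p) (ωT ωN : ℝ)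
    (y x : Mat n p) (d : Mat n r × Mat n r × Ξ) : Mat n p :=
  landingField f ωT ωN y - sketchDir G ωT ωN y d + sketchDir G ωT ωN x d

lemma svrgDir_eq {n p r : ℕ} {Ξ : Type*} (f : Mat n p → ℝ) (G : Ξ → Mat n p → Mat n p)
    (ωT ωN : ℝ) (y x : Mat n p) (d : Mat n r × Mat n r × Ξ) :
    ωT • svrgTangent f (G d.2.2) d.1 d.2.1 y x + ωN • svrgNormal d.1 d.2.1 y x
      = svrgDir f G ωT ωN y x d := by
  simp only [svrgTangent, svrgNormal, svrgDir, landingField, sketchDir, smul_add, smul_sub]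
  abel

lemma norm_sq_sub_add_le {E : Type*} [SeminormedAddCommGroup E] (a b c : E) :
    ‖a - b + c‖ ^ 2 ≤ 3 * (‖a‖ ^ 2 + ‖b‖ ^ 2 + ‖c‖ ^ 2) := by
  have h : ‖a - b + c‖ ≤ ‖a‖ + ‖b‖ + ‖c‖ :=
    (norm_add_le _ _).trans (add_le_add_left (norm_sub_le a b) _)
  have h2 : ‖a - b + c‖ ^ 2 ≤ (‖a‖ + ‖b‖ + ‖c‖) ^ 2 := by gcongr
  nlinarith [sq_nonneg (‖a‖ - ‖b‖), sq_nonneg (‖b‖ - ‖c‖), sq_nonneg (‖a‖ - ‖c‖)]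

section Runs

variable {n p r : ℕ} {Ξ : Type*} [MeasurableSpace Ξ] {G : Ξ → Mat n p → Mat n p}
  {f : Mat n p → ℝ} {𝒞 : Set (Mat n p)} {π : Measure Ξ} {ν : Measure (Mat n r)} {ωT ωN : ℝ}

lemma measurable_sketchDir_comp {α : Type*} [MeasurableSpace α]
    (hG : Measurable (Function.uncurry G)) {x : α → Mat n p} {d : α → Mat n r × Mat n r × Ξ}
    (hx : Measurable x) (hd : Measurable d) :
    Measurable fun a => sketchDir G ωT ωN (x a) (d a) :=
  Measurable.comp (g := fun z : Mat n p × Mat n r × Mat n r × Ξ => sketchDir G ωT ωN z.1 z.2)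
    (f := fun a => (x a, d a)) (measurable_sketchDir hG ωT ωN) (hx.prodMk hd)

attribute [local irreducible] sketchDir landingField

lemma measurable_svrgDir (hf : ContDiff ℝ 1 f) (hG : Measurable (Function.uncurry G)) :
    Measurable fun z : (Mat n p × Mat n p) × (Mat n r × Mat n r × Ξ) =>
      svrgDir f G ωT ωN z.1.1 z.1.2 z.2 := by
  have h1 : Measurable fun z : (Mat n p × Mat n p) × (Mat n r × Mat n r × Ξ) =>
      sketchDir G ωT ωN z.1.1 z.2 :=
    measurable_sketchDir_comp hG (measurable_fst.comp measurable_fst) measurable_snd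
  have h2 : Measurable fun z : (Mat n p × Mat n p) × (Mat n r × Mat n r × Ξ) =>
      sketchDir G ωT ωN z.1.2 z.2 :=
    measurable_sketchDir_comp hG (measurable_snd.comp measurable_fst) measurable_snd
  have h3 : Measurable fun z : (Mat n p × Mat n p) × (Mat n r × Mat n r × Ξ) =>
      landingField f ωT ωN z.1.1 :=
    Measurable.comp (g := landingField f ωT ωN) (continuous_landingField hf ωT ωN).measurable
      (measurable_fst.comp measurable_fst)
  exact (h3.sub h1).add h2

lemma integrable_norm_sq_svrgDir (hν : IsSketchLaw ν)
    (hG : IsStochGrad f 𝒞 π G) {y x : Mat n p} (hy : y ∈ 𝒞) (hx : x ∈ 𝒞) :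
    Integrable (fun d => ‖svrgDir f G ωT ωN y x d‖ ^ 2) (ν.prod (ν.prod π)) := by
  have := hν.isProbabilityMeasure
  have := hG.isProbabilityMeasure
  have hm : Measurable (svrgDir f G ωT ωN y x : Mat n r × Mat n r × Ξ → Mat n p) :=
    (measurable_const.sub (measurable_sketchDir_comp hG.measurable measurable_const
      measurable_id)).add (measurable_sketchDir_comp hG.measurable measurable_const measurable_id)
  refine ((((integrable_const (‖landingField f ωT ωN y‖ ^ 2)).add
    (integrable_norm_sq_sketchDir hν hG hy ωT ωN)).add
    (integrable_norm_sq_sketchDir hν hG hx ωT ωN)).const_mul 3).mono'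
    (hm.norm.pow_const 2).aestronglyMeasurable (Filter.Eventually.of_forall fun d => ?_)
  rw [Real.norm_eq_abs, abs_of_nonneg (sq_nonneg _)]
  exact norm_sq_sub_add_le _ _ _

/-- A crude bound suffices: the rate needs only bounded second moments, with no gain from the
closeness of `y` and `x`. -/
lemma integral_norm_sq_svrgDir_le (hν : IsSketchLaw ν)
    (hG : IsStochGrad f 𝒞 π G) {y x : Mat n p} (hy : y ∈ 𝒞) (hx : x ∈ 𝒞) :
    ∫ d, ‖svrgDir f G ωT ωN y x d‖ ^ 2 ∂(ν.prod (ν.prod π)) ≤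
      3 * (‖landingField f ωT ωN y‖ ^ 2
        + ∫ d, ‖sketchDir G ωT ωN y d‖ ^ 2 ∂(ν.prod (ν.prod π))
        + ∫ d, ‖sketchDir G ωT ωN x d‖ ^ 2 ∂(ν.prod (ν.prod π))) := by
  have := hν.isProbabilityMeasure
  have := hG.isProbabilityMeasure
  have i1 := integrable_norm_sq_sketchDir hν hG hy ωT ωN
  have i2 := integrable_norm_sq_sketchDir hν hG hx ωT ωN
  have i0 : Integrable (fun d => ‖landingField f ωT ωN y‖ ^ 2 + ‖sketchDir G ωT ωN y d‖ ^ 2)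
      (ν.prod (ν.prod π)) := (integrable_const _).add i1
  have h := integral_mono (integrable_norm_sq_svrgDir (ωT := ωT) (ωN := ωN) hν hG hy hx)
    ((i0.add i2).const_mul 3) fun d => norm_sq_sub_add_le _ _ _
  refine h.trans_eq ?_
  rw [integral_const_mul]
  simp only [Pi.add_apply]
  rw [integral_add i0 i2, integral_add (integrable_const _) i1]
  simp

lemma integrable_svrgDir (hν : IsSketchLaw ν) (hG : IsStochGrad f 𝒞 π G) {y x : Mat n p}
    (hy : y ∈ 𝒞) (hx : x ∈ 𝒞) : Integrable (svrgDir f G ωT ωN y x) (ν.prod (ν.prod π)) := by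
  have := hν.isProbabilityMeasure
  have := hG.isProbabilityMeasure
  exact ((integrable_const _).sub (integrable_sketchDir hν hG hy ωT ωN)).add
    (integrable_sketchDir hν hG hx ωT ωN)

/-- The correction at the reference point has mean zero, so `y` drops out of the mean field. -/
lemma integral_svrgDir (hν : IsSketchLaw ν) (hG : IsStochGrad f 𝒞 π G) {y x : Mat n p}
    (hy : y ∈ 𝒞) (hx : x ∈ 𝒞) :
    ∫ d, svrgDir f G ωT ωN y x d ∂(ν.prod (ν.prod π)) = landingField f ωT ωN x := by
  have := hν.isProbabilityMeasure
  have := hG.isProbabilityMeasure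
  have i1 := integrable_sketchDir hν hG hy ωT ωN
  have i2 := integrable_sketchDir hν hG hx ωT ωN
  have i0 : Integrable (fun d => landingField f ωT ωN y - sketchDir G ωT ωN y d)
      (ν.prod (ν.prod π)) := (integrable_const _).sub i1
  unfold svrgDir
  rw [integral_add i0 i2, integral_sub (integrable_const _) i1, integral_sketchDir hν hG hy,
    integral_sketchDir hν hG hx]
  simp

end Runs

/-- Both methods have a common Lyapunov function on the safe region. -/
theorem exists_isLyapunov {n p r : ℕ} {Ξ : Type*} [MeasurableSpace Ξ]
    {G : Ξ → Mat n p → Mat n p} {f : Mat n p → ℝ} {π : Measure Ξ} {ν : Measure (Mat n r)}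
    {ωT ωN σ R : ℝ} (hf : ContDiff ℝ 2 f) (hωT : 0 < ωT) (hωN : 0 < ωN) (hσ : 0 < σ)
    (hsafe : ∀ X ∈ safeRegion n p R, σ ≤ sigmaMin (constraintDeriv X))
    (hν : IsSketchLaw ν) (hG : IsStochGrad f (safeRegion n p R) π G) :
    ∃ (L : Mat n p → ℝ) (c B M Lmax : ℝ), ContDiff ℝ 2 L ∧ 0 < c ∧ 0 ≤ B ∧ 0 ≤ Lmax ∧
      IsLyapunov (ν.prod (ν.prod π)) (safeRegion n p R) (fun _ => sketchDir G ωT ωN)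
        (landingField f ωT ωN) L (fderiv ℝ L)
        (fun X => c * (‖riemGrad f X‖ ^ 2 + ‖gramDefect X‖ ^ 2)) B M Lmax ∧
      IsLyapunov (ν.prod (ν.prod π)) (safeRegion n p R) (svrgDir f G ωT ωN)
        (landingField f ωT ωN) L (fderiv ℝ L)
        (fun X => c * (‖riemGrad f X‖ ^ 2 + ‖gramDefect X‖ ^ 2)) B M Lmax := by
  have hf1 : ContDiff ℝ 1 f := hf.of_le one_le_two
  have hK := isCompact_safeRegion n p R
  obtain ⟨L, c, M, Lmax, hL, hc, hM, hLmax, hup, hmodel, hdesc, hmax⟩ :=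
    exists_lyapunov hf hωT hωN hσ hsafe
  obtain ⟨ρ, -, hρ⟩ := exists_forall_norm_le hK (continuous_id (X := Mat n p))
  obtain ⟨γ, -, hγ⟩ := exists_forall_norm_le hK (continuous_gradient hf1)
  obtain ⟨lam, hlam0, hlam⟩ := exists_forall_norm_le hK (continuous_landingField hf1 ωT ωN)
  obtain ⟨B, hB0, hB⟩ := exists_integral_norm_sq_sketchDir_le hν hG hρ hγ ωT ωN
  have hB3 : B ≤ 3 * (lam ^ 2 + B + B) := by nlinarith [sq_nonneg lam]
  -- The second moment constant of SVRG also dominates that of the plain method, so one constant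
  -- covers both.
  refine ⟨L, c, 3 * (lam ^ 2 + B + B), M, Lmax, hL, hc, by positivity, hLmax, ?_, ?_⟩
  · exact {
      integrable := fun _ _ x hx => integrable_sketchDir hν hG hx ωT ωN
      mean := fun _ _ x hx => integral_sketchDir hν hG hx ωT ωN
      integrable_sq := fun _ _ x hx => integrable_norm_sq_sketchDir hν hG hx ωT ωN
      second_moment := fun _ _ x hx => (hB x hx).trans hB3
      nonneg := hM
      upper := hup
      model_nonneg := hmodel
      descent := hdesc
      rate_nonneg := fun x _ => by positivity
      le_max := hmax }
  · exact {
      integrable := fun y hy x hx => integrable_svrgDir hν hG hy hx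
      mean := fun y hy x hx => integral_svrgDir hν hG hy hx
      integrable_sq := fun y hy x hx => integrable_norm_sq_svrgDir hν hG hy hx
      second_moment := fun y hy x hx => (integral_norm_sq_svrgDir_le hν hG hy hx).trans (by
        have h1 := hlam y hy
        have h2 := hB y hy
        have h3 := hB x hx
        gcongr)
      nonneg := hM
      upper := hup
      model_nonneg := hmodel
      descent := hdesc
      rate_nonneg := fun x _ => by positivity
      le_max := hmax }

/-- The rate of both methods, stopped upon leaving the safe region. -/
theorem exists_rate {n p r T : ℕ} {Ξ : Type*} [MeasurableSpace Ξ]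
    {G : Ξ → Mat n p → Mat n p} {f : Mat n p → ℝ} {π : Measure Ξ} {ν : Measure (Mat n r)}
    {ωT ωN σ R : ℝ} (hf : ContDiff ℝ 2 f) (hωT : 0 < ωT) (hωN : 0 < ωN) (hσ : 0 < σ)
    (hsafe : ∀ X ∈ safeRegion n p R, σ ≤ sigmaMin (constraintDeriv X))
    (hν : IsSketchLaw ν) (hG : IsStochGrad f (safeRegion n p R) π G) {α₀ : ℝ} (hα : 0 < α₀) :
    ∃ C : ℝ, ∀ (Ω : Type*) [MeasurableSpace Ω] (P : Measure Ω) [IsProbabilityMeasure P]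
      (S S' : ℕ → Ω → Mat n r) (ξ : ℕ → Ω → Ξ), IsSampling P ν π S S' ξ →
      ∀ (X₀ : Mat n p) (X : ℕ → Ω → Mat n p),
        (IsSketchedLandingRun G ωT ωN (fun k => α₀ / √((k : ℝ) + 1)) S S' ξ X₀ X ∨
          IsSVRGLandingRun f G T ωT ωN (fun k => α₀ / √((k : ℝ) + 1)) S S' ξ X₀ X) →
        ∀ K : ℕ, 1 ≤ K → ∃ k ≤ K, ∫⁻ ω in safeUpTo R X k,
          ENNReal.ofReal (‖riemGrad f (X k ω)‖ ^ 2 + ‖gramDefect (X k ω)‖ ^ 2) ∂P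
            ≤ ENNReal.ofReal (C * (1 + Real.log K) / √K) := by
  have hf1 : ContDiff ℝ 1 f := hf.of_le one_le_two
  have := hν.isProbabilityMeasure
  have := hG.isProbabilityMeasure
  obtain ⟨L, c, B, M, Lmax, hL, hc, hB, hLmax, hlyap, hlyap'⟩ :=
    exists_isLyapunov hf hωT hωN hσ hsafe hν hG
  have hLc : Continuous (fderiv ℝ L) := hL.continuous_fderiv two_ne_zero
  have h𝒞 : MeasurableSet (safeRegion n p R) := (isCompact_safeRegion n p R).isClosed.measurableSet
  have hQ : Measurable fun X : Mat n p => c * (‖riemGrad f X‖ ^ 2 + ‖gramDefect X‖ ^ 2) :=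
    ((((continuous_riemGrad hf1).norm.pow 2).add (continuous_gramDefect.norm.pow 2)).const_mul
      c).measurable
  refine ⟨(Lmax + 2 * α₀ ^ 2 * (M * B)) / α₀ / c,
    fun Ω _ P _ S S' ξ hs X₀ X hX K hK => ?_⟩
  have hU : Measurable fun z : (Mat n p × Mat n p) × (Mat n r × Mat n r × Ξ) =>
      sketchDir G ωT ωN z.1.2 z.2 :=
    measurable_sketchDir_comp hG.measurable (measurable_snd.comp measurable_fst) measurable_snd
  have hD : ∀ k, Measurable fun ω => (S k ω, S' k ω, ξ k ω) := fun k =>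
    (hs.measurable_sketch k).prodMk ((hs.measurable_sketch' k).prodMk (hs.measurable_sample k))
  have key : ∃ k ≤ K, ∫⁻ ω in safeUpTo R X k,
      ENNReal.ofReal (c * (‖riemGrad f (X k ω)‖ ^ 2 + ‖gramDefect (X k ω)‖ ^ 2)) ∂P
        ≤ ENNReal.ofReal ((Lmax + 2 * α₀ ^ 2 * (M * B)) / α₀ * (1 + Real.log K) / √K) := by
    rcases hX with hX | hX
    -- The plain direction ignores its reference point, so any admissible `j` would do.
    · exact hlyap.exists_le_rate h𝒞 hL.continuous.measurable hLc hQ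
        hU hB hLmax hD hs.law hs.indep hα (j := fun k => k) (fun k => le_rfl) hX.init
        (fun k ω => hX.step k ω) K hK
    · exact hlyap'.exists_le_rate h𝒞 hL.continuous.measurable hLc hQ
        (measurable_svrgDir (r := r) hf1 hG.measurable)
        hB hLmax hD hs.law hs.indep hα (j := fun k => k - k % T) (fun k => Nat.sub_le _ _) hX.init
        (fun k ω => (hX.step k ω).trans (by
          rw [← svrgDir_eq f G ωT ωN _ _ (S k ω, S' k ω, ξ k ω)])) K hK
  obtain ⟨k, hk, h⟩ := key
  refine ⟨k, hk, ?_⟩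
  simp_rw [ENNReal.ofReal_mul hc.le] at h
  rw [lintegral_const_mul' _ _ ENNReal.ofReal_ne_top] at h
  have e : (Lmax + 2 * α₀ ^ 2 * (M * B)) / α₀ / c * (1 + Real.log K) / √K
      = (Lmax + 2 * α₀ ^ 2 * (M * B)) / α₀ * (1 + Real.log K) / √K / c := by
    field_simp
  rw [e, ENNReal.ofReal_div_of_pos hc, ENNReal.le_div_iff_mul_le
    (Or.inl (by simpa using hc)) (Or.inl ENNReal.ofReal_ne_top), mul_comm]
  exact h

end

end SketchedLanding

open SketchedLanding in
theorem mainTheorem1 {n p r N T : ℕ} (hp : 0 < p) (hpn : p ≤ n) (hT : 0 < T)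
    (fi : Fin N → Mat n p → ℝ) (hfi : ∀ i, ContDiff ℝ (⊤ : ℕ∞) (fi i))
    (f : Mat n p → ℝ) (hf : ∀ X, f X = ∑ i, fi i X)
    {R σ : ℝ} (hR : 0 < R) (hσ : 0 < σ)
    (hsafe : ∀ X ∈ safeRegion n p R, σ ≤ sigmaMin (constraintDeriv X))
    {ωT ωN : ℝ} (hωT : 0 < ωT) (hωN : 0 < ωN)
    (ν : Measure (Mat n r)) (hν : IsSketchLaw ν)
    {Ξ : Type*} [MeasurableSpace Ξ] (π : Measure Ξ) (G : Ξ → Mat n p → Mat n p)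
    (hG : IsStochGrad f (safeRegion n p R) π G) :
    ∃ αbar : ℝ, 0 < αbar ∧ ∀ α₀ : ℝ, 0 < α₀ → α₀ ≤ αbar →
      ∃ C : ℝ, ∀ (Ω : Type*) [MeasurableSpace Ω] (P : Measure Ω) [IsProbabilityMeasure P]
        (S S' : ℕ → Ω → Mat n r) (ξ : ℕ → Ω → Ξ), IsSampling P ν π S S' ξ →
        ∀ (X₀ : Mat n p) (X : ℕ → Ω → Mat n p),
          (IsSketchedLandingRun G ωT ωN (fun k => α₀ / √((k : ℝ) + 1)) S S' ξ X₀ X ∨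
            IsSVRGLandingRun f G T ωT ωN (fun k => α₀ / √((k : ℝ) + 1)) S S' ξ X₀ X) →
          ((∀ᵐ ω ∂P, ∀ k, X k ω ∈ safeRegion n p R) → ∀ K : ℕ, 1 ≤ K →
            (⨅ k ≤ K, ∫⁻ ω, ‖riemGrad f (X k ω)‖ₑ ^ 2 ∂P)
                ≤ ENNReal.ofReal (C * (1 + Real.log K) / √K) ∧
            (⨅ k ≤ K, ∫⁻ ω, ‖stiefelConstraint (X k ω)‖ₑ ^ 2 ∂P)
                ≤ ENNReal.ofReal (C * (1 + Real.log K) / √K)) ∧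
          (∀ K : ℕ, 1 ≤ K →
            (⨅ k ≤ K, ∫⁻ ω in safeUpTo R X k, ‖riemGrad f (X k ω)‖ₑ ^ 2 ∂P)
                ≤ ENNReal.ofReal (C * (1 + Real.log K) / √K) ∧
            (⨅ k ≤ K, ∫⁻ ω in safeUpTo R X k, ‖stiefelConstraint (X k ω)‖ₑ ^ 2 ∂P)
                ≤ ENNReal.ofReal (C * (1 + Real.log K) / √K)) := by
  have hf2 : ContDiff ℝ 2 f := by
    have e : f = fun X => ∑ i, fi i X := funext hf
    rw [e]
    exact ContDiff.sum fun i _ => (hfi i).of_le (WithTop.coe_le_coe.2 (le_top : (2 : ℕ∞) ≤ ⊤))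
  -- Any positive bound works: the argument restricts no step size, and `α₀` enters only through
  -- `C`.
  refine ⟨1, one_pos, fun α₀ hα₀ _ => ?_⟩
  obtain ⟨C, hC⟩ := exists_rate (T := T) hf2 hωT hωN hσ hsafe hν hG hα₀
  refine ⟨C, fun Ω _ P _ S S' ξ hs X₀ X hX => ?_⟩
  have key : ∀ K : ℕ, 1 ≤ K →
      (⨅ k ≤ K, ∫⁻ ω in safeUpTo R X k, ‖riemGrad f (X k ω)‖ₑ ^ 2 ∂P)
          ≤ ENNReal.ofReal (C * (1 + Real.log K) / √K) ∧
      (⨅ k ≤ K, ∫⁻ ω in safeUpTo R X k, ‖stiefelConstraint (X k ω)‖ₑ ^ 2 ∂P)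
          ≤ ENNReal.ofReal (C * (1 + Real.log K) / √K) := by
    intro K hK
    obtain ⟨k, hk, h⟩ := hC Ω P S S' ξ hs X₀ X hX K hK
    constructor
    · refine iInf₂_le_of_le k hk (le_trans (lintegral_mono fun ω => ?_) h)
      rw [enorm_sq_eq_ofReal]
      exact ENNReal.ofReal_le_ofReal (le_add_of_nonneg_right (sq_nonneg _))
    · refine iInf₂_le_of_le k hk (le_trans (lintegral_mono fun ω => ?_) h)
      rw [enorm_sq_eq_ofReal, norm_stiefelConstraint]
      exact ENNReal.ofReal_le_ofReal (le_add_of_nonneg_left (sq_nonneg _))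
  refine ⟨fun hmem K hK => ?_, key⟩
  have hr : ∀ k, P.restrict (safeUpTo R X k) = P := fun k =>
    Measure.restrict_eq_self_of_ae_mem (hmem.mono fun ω hω j _ => hω j)
  simpa only [hr] using key K hK
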